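/- Let $\mathcal M$ be a smooth manifold (finite-dimensional, Hausdorff, second countable, without boundary) with a Poisson bivector $\pi$, Poisson bracket $\{f,g\}=\pi(df,dg)$, anchor $\#:T^*\mathcal M\to T\mathcal M$, $(\#\alpha)^i=\pi^{ji}\alpha_j$, and Koszul bracket $[\alpha,\beta]_\pi=\mathcal L_{\#\alpha}\beta-\mathcal L_{\#\beta}\alpha-d(\pi(\alpha,\beta))$. Suppose that $\pi=\omega^{-1}$ is invertible with inverse 2-form $\omega$, i.e. $\pi^{ki}\omega_{ij}=\delta^k_j$. Let $\mathcal D$ be a flat, torsion-free contravariant connection: a map $(\alpha,\beta)\mapsto\mathcal D_\alpha\beta$ on 1-forms, biadditive, with $\mathcal D_{f\alpha}\beta=f\,\mathcal D_\alpha\beta$, $\mathcal D_\alpha(f\beta)=f\,\mathcal D_\alpha\beta+(\#\alpha)(f)\,\beta$, $\mathcal D_\alpha\mathcal D_\beta-\mathcal D_\beta\mathcal D_\alpha=\mathcal D_{[\alpha,\beta]_\pi}$ and $\mathcal D_\alpha\beta-\mathcal D_\beta\alpha=[\alpha,\beta]_\pi$. Extend $\mathcal D$ to all tensors by the product rule,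 and write $\mathcal D_\alpha=\alpha_i\mathcal D^i$. There is a unique affine connection $\nabla$ on $T\mathcal M$ with $\#\mathcal D_\alpha\beta=\nabla_{\#\alpha}\#\beta$, and it is flat and torsion-free. There is a unique tensor $M^{ijk}_{lm}$ (the metacurvature of $\mathcal D$), regarded as a $C^\infty(\mathcal M)$-trilinear map from 1-forms to 2-forms, such that $$M(df,\beta,\gamma)=\mathcal D_{df}\{\beta,\gamma\}-\{\mathcal D_{df}\beta,\gamma\}-\{\mathcal D_{df}\gamma,\beta\}$$ for some symmetric biadditive map $\{\cdot,\cdot\}$ from pairs of 1-forms to 2-forms satisfying $\{f\alpha,\beta\}=f\{\alpha,\beta\}+\alpha\wedge\mathcal D_{df}\beta$ and $d(\mathcal D_{df}\alpha)=\{df,\alpha\}+\mathcal D_{df}\,d\alpha$. It is given by $$M^{ijk}_{lm}=\mathcal D^i\mathcal D^j\mathcal D^k\omega_{lm}=-\pi^{ia}\pi^{jb}\pi^{kc}\,\omega_{dl}\,\omega_{em}\,\nabla_a\nabla_b\nabla_c\pi^{de},$$ the second equality meaning $M(\alpha,\beta,\gamma)(X,Y)=-(\nabla^3_{\#\alpha,\#\beta,\#\gamma}\pi)(\omega(X,\cdot),\omega(Y,\cdot))$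 for all 1-forms $\alpha,\beta,\gamma$ and vector fields $X,Y$. Moreover, $\mathcal M$ is covered by affine charts of $\nabla$ (smooth charts with $\nabla dx^i=0$ for all $i$), and $M=0$ if and only if $\pi$ is quadratic in this affine structure, i.e. in every affine chart each component $\pi^{ij}=\pi(dx^i,dx^j)$ is, near each point of the chart domain, a polynomial of degree at most two in the coordinates. -/

import Mathlib

open scoped Manifold ContDiff Topology

noncomputable section

namespace PoissonGeometry

/-! ### Tensor calculus over an algebra of smooth functions

`A` is the algebra of smooth functions of a manifold. On a finite-dimensional, Hausdorff, second
countable manifold, smooth vector fields are the same as derivations of `A`, and a smooth tensor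
field is the same as an `A`-multilinear map on vector fields and 1-forms. -/

section Algebraic

variable {A : Type*} [CommRing A]

/-- The alternating map defined by a bilinear map `b` with `b v v = 0`. -/
def mkAlt {V : Type*} [AddCommMonoid V] [Module A V] (b : V →ₗ[A] V →ₗ[A] A)
    (hb : ∀ v, b v v = 0) : V [⋀^Fin 2]→ₗ[A] A where
  toFun v := b (v 0) (v 1)
  map_update_add' := by
    intro _ v i x y
    fin_cases i <;> simp
  map_update_smul' := by
    intro _ v i c x
    fin_cases i <;> simp
  map_eq_zero_of_eq' := by
    intro v i j h hij
    have h01 : v 0 = v 1 := by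
      fin_cases i <;> fin_cases j <;> simp_all
    simp [h01, hb]

section Alt

lemma update_zero {V : Type*} (x y z : V) : Function.update ![x, y] 0 z = ![z, y] := by
  ext i; fin_cases i <;> rfl

lemma update_one {V : Type*} (x y z : V) : Function.update ![x, y] 1 z = ![x, z] := by
  ext i; fin_cases i <;> rfl

variable {V : Type*} [AddCommMonoid V] [Module A V] (σ : V [⋀^Fin 2]→ₗ[A] A)

lemma alt_add_left (x x' y : V) : σ ![x + x', y] = σ ![x, y] + σ ![x', y] := by
  have h := σ.map_update_add ![x, y] 0 x x'
  rwa [update_zero, update_zero, update_zero] at h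

lemma alt_smul_left (f : A) (x y : V) : σ ![f • x, y] = f * σ ![x, y] := by
  have h := σ.map_update_smul ![x, y] 0 f x
  rwa [update_zero, update_zero, smul_eq_mul] at h

lemma alt_add_right (x y y' : V) : σ ![x, y + y'] = σ ![x, y] + σ ![x, y'] := by
  have h := σ.map_update_add ![x, y] 1 y y'
  rwa [update_one, update_one, update_one] at h

lemma alt_smul_right (f : A) (x y : V) : σ ![x, f • y] = f * σ ![x, y] := by
  have h := σ.map_update_smul ![x, y] 1 f y
  rwa [update_one, update_one, smul_eq_mul] at h

lemma alt_self (x : V) : σ ![x, x] = 0 :=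
  σ.map_eq_zero_of_eq ![x, x] (i := 0) (j := 1) rfl (by decide)

lemma alt_swap (x y : V) : σ ![x, y] + σ ![y, x] = 0 := by
  have h := alt_self σ (x + y)
  rw [alt_add_left, alt_add_right, alt_add_right, alt_self, alt_self, zero_add, add_zero] at h
  exact h

end Alt

variable [Algebra ℝ A]

variable (A) in
/-- Vector fields. -/
abbrev Vec : Type _ := Derivation ℝ A A

variable (A) in
/-- 1-forms. -/
abbrev Form1 : Type _ := Vec A →ₗ[A] A

variable (A) in
/-- 2-forms. -/
abbrev Form2 : Type _ := Vec A [⋀^Fin 2]→ₗ[A] A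

variable (A) in
/-- Bivector fields: sections of `⋀² T`, as alternating bilinear maps on 1-forms. -/
abbrev Bivec : Type _ := Form1 A [⋀^Fin 2]→ₗ[A] A

/-- The differential of a function: `df(X) = X(f)`. -/
def d0 (f : A) : Form1 A where
  toFun X := X f
  map_add' _ _ := rfl
  map_smul' _ _ := rfl

/-- The exterior derivative of a 1-form: `dα(X,Y) = X(α(Y)) - Y(α(X)) - α([X,Y])`. -/
def d1 (α : Form1 A) : Form2 A :=
  mkAlt (LinearMap.mk₂ A (fun X Y => X (α Y) - Y (α X) - α ⁅X, Y⁆)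
    (by intro X X' Y; simp only [add_lie, map_add, Derivation.add_apply]; ring)
    (by
      intro f X Y
      have h : ⁅f • X, Y⁆ = f • ⁅X, Y⁆ - Y f • X := by
        ext g; simp [Derivation.commutator_apply]; ring
      rw [h]; simp; ring)
    (by intro X Y Y'; simp only [lie_add, map_add, Derivation.add_apply]; ring)
    (by
      intro f X Y
      have h : ⁅X, f • Y⁆ = f • ⁅X, Y⁆ + X f • Y := by
        ext g; simp [Derivation.commutator_apply]
      rw [h]; simp; ring)) (by intro X; simp)

/-- The exterior product of two 1-forms: `(α ∧ β)(X,Y) = α(X) β(Y) - α(Y) β(X)`. -/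
def wedge (α β : Form1 A) : Form2 A :=
  mkAlt (LinearMap.mk₂ A (fun X Y => α X * β Y - α Y * β X)
    (by intro X X' Y; simp; ring) (by intro f X Y; simp; ring)
    (by intro X Y Y'; simp; ring) (by intro f X Y; simp; ring))
    (by intro X; simp)

/-- The Lie derivative of a 1-form: `(L_X β)(Y) = X(β(Y)) - β([X,Y])`. -/
def lieDeriv (X : Vec A) (β : Form1 A) : Form1 A where
  toFun Y := X (β Y) - β ⁅X, Y⁆
  map_add' := by intro Y Y'; simp; ring
  map_smul' := by
    intro f Y
    have h : ⁅X, f • Y⁆ = f • ⁅X, Y⁆ + X f • Y := by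
      ext g; simp [Derivation.commutator_apply]
    rw [h]; simp; ring

/-! ### Poisson structures -/

/-- The bracket of functions `{f,g} = π(df,dg)`. -/
def poissonBracket (π : Bivec A) (f g : A) : A := π ![d0 f, d0 g]

/-- `π` is a Poisson bivector: its bracket satisfies the Jacobi identity. -/
def IsPoisson (π : Bivec A) : Prop :=
  ∀ f g h : A, poissonBracket π f (poissonBracket π g h) +
    poissonBracket π g (poissonBracket π h f) + poissonBracket π h (poissonBracket π f g) = 0

lemma d0_add (f g : A) : d0 (f + g) = d0 f + d0 g := by
  ext X; simp [d0]

lemma d0_smul (r : ℝ) (f : A) : d0 (r • f) = algebraMap ℝ A r • d0 f := by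
  ext X; simp [d0, Algebra.smul_def]

lemma d0_mul (f g : A) : d0 (f * g) = f • d0 g + g • d0 f := by
  ext X; simp [d0]

lemma d0_one : d0 (1 : A) = 0 := by
  ext X; simp [d0]

/-- The anchor `# : T* → T`, `(#α)^i = π^{ji} α_j`, that is `(#α)(f) = π(α, df)`. -/
def sharp (π : Bivec A) (α : Form1 A) : Vec A where
  toFun f := π ![α, d0 f]
  map_add' := by intro f g; simp [d0_add, alt_add_right]
  map_smul' := by intro r f; rw [d0_smul, alt_smul_right, RingHom.id_apply, Algebra.smul_def]
  map_one_eq_zero' := by simpa [d0_one] using alt_smul_right π 0 α 0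
  leibniz' := by intro f g; simp [d0_mul, alt_add_right, alt_smul_right]

/-- The contraction `X ⌟ ω = ω(X, ·)`. -/
def flat (Om : Form2 A) (X : Vec A) : Form1 A where
  toFun Y := Om ![X, Y]
  map_add' := alt_add_right Om X
  map_smul' f Y := alt_smul_right Om f X Y

/-- `π = ω⁻¹`, i.e. `π^{ki} ω_{ij} = δ^k_j`: the maps `α ↦ #α` and `X ↦ ω(X, ·)` are mutually
inverse. -/
def IsInverse (π : Bivec A) (Om : Form2 A) : Prop :=
  (∀ α : Form1 A, flat Om (sharp π α) = α) ∧ (∀ X : Vec A, sharp π (flat Om X) = X)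

/-- The Koszul bracket `[α,β]_π = L_{#α} β - L_{#β} α - d(π(α,β))`. -/
def koszul (π : Bivec A) (α β : Form1 A) : Form1 A :=
  lieDeriv (sharp π α) β - lieDeriv (sharp π β) α - d0 (π ![α, β])

/-! ### Contravariant connections -/

/-- A contravariant connection on the cotangent bundle of a Poisson manifold: a connection on `T*`
with respect to the Lie algebroid `T*` with anchor `#`. -/
@[ext]
structure ContravariantConnection (π : Bivec A) where
  toFun : Form1 A → Form1 A → Form1 A
  add_left : ∀ α α' β, toFun (α + α') β = toFun α β + toFun α' β
  smul_left : ∀ (f : A) α β, toFun (f • α) β = f • toFun α β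
  add_right : ∀ α β β', toFun α (β + β') = toFun α β + toFun α β'
  leibniz : ∀ α (f : A) β, toFun α (f • β) = f • toFun α β + (sharp π α) f • β

namespace ContravariantConnection

variable {π : Bivec A} (D : ContravariantConnection π)

/-- `K(α,β)γ = D_α D_β γ - D_β D_α γ - D_{[α,β]_π} γ` vanishes. -/
def IsFlat : Prop := ∀ α β γ : Form1 A,
  D.toFun α (D.toFun β γ) - D.toFun β (D.toFun α γ) - D.toFun (koszul π α β) γ = 0

/-- `T(α,β) = D_α β - D_β α - [α,β]_π` vanishes. -/
def IsTorsionFree : Prop := ∀ α β : Form1 A,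
  D.toFun α β - D.toFun β α - koszul π α β = 0

/-- The dual connection on vector fields, given by `β(D_α X) = #α(β(X)) - (D_α β)(X)`; the vector
field `D_α X` is described by its action on functions, i.e. by this formula for `β = df`. -/
def onVec (α : Form1 A) (X : Vec A) : Vec A where
  toFun f := sharp π α (X f) - D.toFun α (d0 f) X
  map_add' := by intro f g; simp [d0_add, D.add_right]; ring
  map_smul' := by
    intro r f
    rw [d0_smul, D.leibniz]
    simp [Algebra.smul_def]
    ring
  map_one_eq_zero' := by
    have h : D.toFun α (0 : Form1 A) = 0 := by simpa using D.leibniz α 0 0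
    simp [d0_one, h]
  leibniz' := by
    intro f g
    simp [d0_mul, D.add_right, D.leibniz]
    simp [d0]
    ring

lemma onVec_add (α : Form1 A) (X Y : Vec A) : D.onVec α (X + Y) = D.onVec α X + D.onVec α Y := by
  ext f; simp [onVec]; ring

lemma onVec_smul (α : Form1 A) (f : A) (X : Vec A) :
    D.onVec α (f • X) = f • D.onVec α X + sharp π α f • X := by
  ext g; simp [onVec]; ring

/-- The induced connection on 2-forms:
`(D_α σ)(X,Y) = #α(σ(X,Y)) - σ(D_α X, Y) - σ(X, D_α Y)`. -/
def onForm2 (α : Form1 A) (σ : Form2 A) : Form2 A :=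
  mkAlt (LinearMap.mk₂ A
    (fun X Y => sharp π α (σ ![X, Y]) - σ ![D.onVec α X, Y] - σ ![X, D.onVec α Y])
    (by intro X X' Y; simp [onVec_add, alt_add_left]; ring)
    (by intro f X Y; simp [onVec_smul, alt_add_left, alt_smul_left]; ring)
    (by intro X Y Y'; simp [onVec_add, alt_add_right]; ring)
    (by intro f X Y; simp [onVec_smul, alt_add_right, alt_smul_right]; ring))
    (by
      intro X
      simp only [LinearMap.mk₂_apply, alt_self, map_zero]
      linear_combination -alt_swap σ X (D.onVec α X))

/-- The second contravariant derivative `(D²σ)(β,γ) = β_j γ_k D^j D^k σ` of a 2-form. -/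
def deriv2 (σ : Form2 A) (β γ : Form1 A) : Form2 A :=
  D.onForm2 β (D.onForm2 γ σ) - D.onForm2 (D.toFun β γ) σ

/-- The third contravariant derivative `(D³σ)(α,β,γ) = α_i β_j γ_k D^i D^j D^k σ` of a 2-form. -/
def deriv3 (σ : Form2 A) (α β γ : Form1 A) : Form2 A :=
  D.onForm2 α (D.deriv2 σ β γ) - D.deriv2 σ (D.toFun α β) γ - D.deriv2 σ β (D.toFun α γ)

/-- `B` is a generalized Poisson bracket of 1-forms: a symmetric biadditive map from 1-forms to
2-forms with the product identity `{fα, β} = f{α, β} + α ∧ {f, β}` and the Leibniz identity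
`d{f, α} = {df, α} + {f, dα}`, where `{f, σ} = D_{df} σ`. -/
structure IsFormBracket (B : Form1 A → Form1 A → Form2 A) : Prop where
  symm : ∀ α β, B α β = B β α
  add_left : ∀ α α' β, B (α + α') β = B α β + B α' β
  product : ∀ (f : A) α β, B (f • α) β = f • B α β + wedge α (D.toFun (d0 f) β)
  leibniz : ∀ (f : A) α, d1 (D.toFun (d0 f) α) = B (d0 f) α + D.onForm2 (d0 f) (d1 α)

/-- `M` is the metacurvature of `D`: the tensor, trilinear over the functions, with
`M(df,β,γ) = {f,{β,γ}} - {{f,β},γ} - {{f,γ},β}`. -/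
def IsMetacurvature (M : Form1 A →ₗ[A] Form1 A →ₗ[A] Form1 A →ₗ[A] Form2 A) : Prop :=
  ∃ B : Form1 A → Form1 A → Form2 A, D.IsFormBracket B ∧
    ∀ (f : A) (β γ : Form1 A), M (d0 f) β γ =
      D.onForm2 (d0 f) (B β γ) - B (D.toFun (d0 f) β) γ - B (D.toFun (d0 f) γ) β

end ContravariantConnection

/-! ### Affine connections -/

variable (A) in
/-- A (covariant) connection on the tangent bundle. -/
@[ext]
structure AffineConnection where
  toFun : Vec A → Vec A → Vec A
  add_left : ∀ X X' Y, toFun (X + X') Y = toFun X Y + toFun X' Y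
  smul_left : ∀ (f : A) X Y, toFun (f • X) Y = f • toFun X Y
  add_right : ∀ X Y Y', toFun X (Y + Y') = toFun X Y + toFun X Y'
  leibniz : ∀ X (f : A) Y, toFun X (f • Y) = f • toFun X Y + X f • Y

namespace AffineConnection

variable (nabla : AffineConnection A)

/-- The curvature vanishes. -/
def IsFlat : Prop := ∀ X Y Z : Vec A,
  nabla.toFun X (nabla.toFun Y Z) - nabla.toFun Y (nabla.toFun X Z) - nabla.toFun ⁅X, Y⁆ Z = 0

/-- The torsion vanishes. -/
def IsTorsionFree : Prop := ∀ X Y : Vec A,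
  nabla.toFun X Y - nabla.toFun Y X - ⁅X, Y⁆ = 0

/-- The dual connection on 1-forms: `(∇_X α)(Y) = X(α(Y)) - α(∇_X Y)`. -/
def onForm1 (X : Vec A) (α : Form1 A) : Form1 A where
  toFun Y := X (α Y) - α (nabla.toFun X Y)
  map_add' := by intro Y Y'; simp [nabla.add_right]; ring
  map_smul' := by intro f Y; simp [nabla.leibniz]; ring

lemma onForm1_add (X : Vec A) (α β : Form1 A) :
    nabla.onForm1 X (α + β) = nabla.onForm1 X α + nabla.onForm1 X β := by
  apply LinearMap.ext; intro Y; simp [onForm1]; ring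

lemma onForm1_smul (X : Vec A) (f : A) (α : Form1 A) :
    nabla.onForm1 X (f • α) = f • nabla.onForm1 X α + X f • α := by
  apply LinearMap.ext; intro Y; simp [onForm1]; ring

/-- The induced connection on bivector fields:
`(∇_X P)(α,β) = X(P(α,β)) - P(∇_X α, β) - P(α, ∇_X β)`. -/
def onBivec (X : Vec A) (P : Bivec A) : Bivec A :=
  mkAlt (LinearMap.mk₂ A
    (fun α β => X (P ![α, β]) - P ![nabla.onForm1 X α, β] - P ![α, nabla.onForm1 X β])
    (by intro α α' β; simp [onForm1_add, alt_add_left]; ring)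
    (by intro f α β; simp [onForm1_smul, alt_add_left, alt_smul_left]; ring)
    (by intro α β β'; simp [onForm1_add, alt_add_right]; ring)
    (by intro f α β; simp [onForm1_smul, alt_add_right, alt_smul_right]; ring))
    (by
      intro α
      simp only [LinearMap.mk₂_apply, alt_self, map_zero]
      linear_combination -alt_swap P α (nabla.onForm1 X α))

/-- The second covariant derivative `(∇²P)(X,Y)` of a bivector field. -/
def deriv2 (P : Bivec A) (X Y : Vec A) : Bivec A :=
  nabla.onBivec X (nabla.onBivec Y P) - nabla.onBivec (nabla.toFun X Y) P

/-- The third covariant derivative `(∇³P)(X,Y,Z)` of a bivector field. -/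
def deriv3 (P : Bivec A) (X Y Z : Vec A) : Bivec A :=
  nabla.onBivec X (nabla.deriv2 P Y Z) - nabla.deriv2 P (nabla.toFun X Y) Z
    - nabla.deriv2 P Y (nabla.toFun X Z)

end AffineConnection

/-- `∇` is the covariant connection associated with `D`: `#(D_α β) = ∇_{#α} #β`. -/
def IsAssociated {π : Bivec A} (D : ContravariantConnection π) (nabla : AffineConnection A) :
    Prop :=
  ∀ α β : Form1 A, sharp π (D.toFun α β) = nabla.toFun (sharp π α) (sharp π β)

end Algebraic

/-! ### Manifolds and affine charts -/

section Manifold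

variable {n : ℕ} {M : Type*} [TopologicalSpace M] [ChartedSpace (EuclideanSpace ℝ (Fin n)) M]

variable (n M) in
/-- The algebra of smooth real functions on `M`. -/
abbrev Smooth : Type _ := C^∞⟮𝓡 n, M; ℝ⟯

/-- The globally defined smooth function `f` agrees with the `i`-th coordinate of the chart `e`
near `p`. -/
def IsCoordNear (e : OpenPartialHomeomorph M (EuclideanSpace ℝ (Fin n))) (i : Fin n) (p : M)
    (f : Smooth n M) : Prop :=
  ∀ᶠ q in 𝓝 p, f q = e q i

/-- `e` is a smooth chart whose coordinates are affine for `∇`: `∇dx^i = 0`, that is,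
`X(Y(x^i)) - (∇_X Y)(x^i) = 0` on the domain of `e`. The coordinate `x^i` is only defined on the
domain of `e`; near each point it is replaced by a smooth function on `M` that agrees with it. -/
def IsAffineChart (nabla : AffineConnection (Smooth n M))
    (e : OpenPartialHomeomorph M (EuclideanSpace ℝ (Fin n))) : Prop :=
  e ∈ IsManifold.maximalAtlas (𝓡 n) ∞ M ∧
  ∀ p ∈ e.source, ∀ (i : Fin n) (f : Smooth n M), IsCoordNear e i p f →
    ∀ X Y : Vec (Smooth n M), nabla.onForm1 X (d0 f) Y p = 0

/-- `π` is quadratic in the affine structure of `∇`: in every affine chart, each component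
`π^{ij} = π(dx^i, dx^j)` is, near each point of the chart domain, a polynomial of degree at most
two in the coordinates. -/
def IsQuadratic (nabla : AffineConnection (Smooth n M)) (π : Bivec (Smooth n M)) : Prop :=
  ∀ e : OpenPartialHomeomorph M (EuclideanSpace ℝ (Fin n)), IsAffineChart nabla e →
    ∀ p ∈ e.source, ∀ (i j : Fin n) (f g : Smooth n M),
      IsCoordNear e i p f → IsCoordNear e j p g →
      ∃ P : MvPolynomial (Fin n) ℝ, P.totalDegree ≤ 2 ∧
        ∀ᶠ q in 𝓝 p, π ![d0 f, d0 g] q = MvPolynomial.eval (fun k => e q k) P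

end Manifold

end PoissonGeometry

end

open PoissonGeometry

/-! All tensor algebra takes place over the algebra of smooth functions, with one analytic input: a
function-linear functional on 1-forms that kills every exact form is zero
(`exactFormsSeparate_smooth`). This replaces the frame dxⁱ: a tensor identity has to be checked on
differentials only, where the Jacobi identity applies directly. So the anchor is a Lie algebra
homomorphism (`sharp_koszul`). As π is invertible, ω is then closed, and conjugation by # carries D
to an affine connection ∇ that is again flat and torsion-free.

The metacurvature comes from an explicit bracket of 1-forms. For a local D-parallel frame θᵢ and α =
aⁱθᵢ, β = bʲθⱼ, it is {α,β} = D²ω(α,β) + {aⁱ,bʲ} θᵢ∧θⱼ. The second summand accounts for the product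
identity; the first is tensorial and is what the Leibniz identity demands, by the formula `d1_eq`
for d in terms of D. No frame is ever chosen: `gradForm` is the invariant form of θᵢ(X) daⁱ. The two
identities determine the bracket. By Jacobi, D_{df} acts on the second summand as a derivation, so
this summand drops out of M and D³ω is left. Lowering indices with ω intertwines ∇_{#α} on bivectors
with D_α on 2-forms and takes π to ω with the sign in `lowerBivec`; hence D³ω is the lowered −∇³π.

Affine coordinates are functions u with ∇du = 0, that is, solutions of a linear total differential
equation for the pair (u, du), whose integrability conditions are flatness and torsion-freeness. The
Frobenius theorem is proved by solving along rays and comparing neighbouring rays with Gronwall's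
inequality; the inverse function theorem then gives charts. In such a chart ∇³π consists of the
third partial derivatives of the components of π, and these vanish locally exactly when the
components are polynomials of degree at most two. -/

noncomputable section

namespace PoissonGeometry

section Alternating

variable {A : Type*} [CommRing A]

lemma alt_swap_eq {V : Type*} [AddCommMonoid V] [Module A V] (σ : V [⋀^Fin 2]→ₗ[A] A) (x y : V) :
    σ ![x, y] = -σ ![y, x] := eq_neg_of_add_eq_zero_left (alt_swap σ x y)

lemma alt_ext {V : Type*} [AddCommMonoid V] [Module A V] {σ τ : V [⋀^Fin 2]→ₗ[A] A}
    (h : ∀ x y, σ ![x, y] = τ ![x, y]) : σ = τ := by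
  ext v
  have hv : v = ![v 0, v 1] := by ext i; fin_cases i <;> rfl
  rw [hv]; exact h _ _

lemma alt_neg_left {V : Type*} [AddCommGroup V] [Module A V] (σ : V [⋀^Fin 2]→ₗ[A] A) (x y : V) :
    σ ![-x, y] = -σ ![x, y] := by
  have h := alt_smul_left σ (-1) x y
  simpa using h

lemma alt_sub_left {V : Type*} [AddCommGroup V] [Module A V] (σ : V [⋀^Fin 2]→ₗ[A] A)
    (x x' y : V) : σ ![x - x', y] = σ ![x, y] - σ ![x', y] := by
  rw [sub_eq_add_neg, alt_add_left, alt_neg_left, sub_eq_add_neg]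

lemma alt_sub_right {V : Type*} [AddCommGroup V] [Module A V] (σ : V [⋀^Fin 2]→ₗ[A] A)
    (x y y' : V) : σ ![x, y - y'] = σ ![x, y] - σ ![x, y'] := by
  rw [alt_swap_eq, alt_sub_left, alt_swap_eq σ x y, alt_swap_eq σ x y']; ring

end Alternating

/-! ### Poisson and contravariant calculus when exact forms separate -/

section Algebraic

variable {A : Type*} [CommRing A] [Algebra ℝ A]

variable (A) in
/-- A linear functional on 1-forms that vanishes on all differentials of functions is zero. -/
def ExactFormsSeparate : Prop :=
  ∀ T : Form1 A →ₗ[A] A, (∀ f : A, T (d0 f) = 0) → T = 0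

lemma d0_apply (f : A) (X : Vec A) : d0 f X = X f := rfl

lemma d1_apply (α : Form1 A) (X Y : Vec A) :
    d1 α ![X, Y] = X (α Y) - Y (α X) - α ⁅X, Y⁆ := rfl

lemma wedge_apply (α β : Form1 A) (X Y : Vec A) :
    wedge α β ![X, Y] = α X * β Y - α Y * β X := rfl

lemma lieDeriv_apply (X : Vec A) (β : Form1 A) (Y : Vec A) :
    lieDeriv X β Y = X (β Y) - β ⁅X, Y⁆ := rfl

lemma sharp_apply (π : Bivec A) (α : Form1 A) (f : A) : sharp π α f = π ![α, d0 f] := rfl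

lemma flat_apply (Om : Form2 A) (X Y : Vec A) : flat Om X Y = Om ![X, Y] := rfl

lemma poissonBracket_apply (π : Bivec A) (f g : A) : poissonBracket π f g = π ![d0 f, d0 g] := rfl

lemma koszul_apply (π : Bivec A) (α β : Form1 A) (Z : Vec A) :
    koszul π α β Z = sharp π α (β Z) - β ⁅sharp π α, Z⁆ - (sharp π β (α Z) - α ⁅sharp π β, Z⁆)
      - Z (π ![α, β]) := rfl

lemma lie_smul_vec (X : Vec A) (f : A) (Y : Vec A) : ⁅X, f • Y⁆ = f • ⁅X, Y⁆ + X f • Y := by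
  ext g; simp [Derivation.commutator_apply]

lemma sharp_add (π : Bivec A) (α β : Form1 A) : sharp π (α + β) = sharp π α + sharp π β := by
  ext f; simp [sharp_apply, alt_add_left]

lemma sharp_smul (π : Bivec A) (f : A) (α : Form1 A) : sharp π (f • α) = f • sharp π α := by
  ext g; simp [sharp_apply, alt_smul_left]

lemma sharp_zero (π : Bivec A) : sharp π 0 = 0 := by
  simpa using sharp_smul π 0 0

lemma sharp_sub (π : Bivec A) (α β : Form1 A) : sharp π (α - β) = sharp π α - sharp π β := by
  ext f; simp [sharp_apply, alt_sub_left]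

lemma flat_add (Om : Form2 A) (X Y : Vec A) : flat Om (X + Y) = flat Om X + flat Om Y :=
  LinearMap.ext fun Z => alt_add_left Om X Y Z

lemma flat_smul (Om : Form2 A) (f : A) (X : Vec A) : flat Om (f • X) = f • flat Om X :=
  LinearMap.ext fun Z => alt_smul_left Om f X Z

/-- The working form of the hypothesis, for unbundled expressions in α: additivity and homogeneity
are side goals, and the identity itself remains for differentials only. -/
lemma ExactFormsSeparate.eq (hA : ExactFormsSeparate A) {T T' : Form1 A → A}
    (hadd : ∀ α β, T (α + β) = T α + T β) (hsmul : ∀ (f : A) α, T (f • α) = f * T α)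
    (hadd' : ∀ α β, T' (α + β) = T' α + T' β) (hsmul' : ∀ (f : A) α, T' (f • α) = f * T' α)
    (h : ∀ f, T (d0 f) = T' (d0 f)) (α : Form1 A) : T α = T' α := by
  let S : Form1 A →ₗ[A] A := ⟨⟨T, hadd⟩, hsmul⟩
  let S' : Form1 A →ₗ[A] A := ⟨⟨T', hadd'⟩, hsmul'⟩
  have := hA (S - S') (fun f => sub_eq_zero.2 (h f))
  exact LinearMap.congr_fun (sub_eq_zero.1 this) α

/-- `π(α, γ) = γ(#α)`. -/
lemma pairing_eq (hA : ExactFormsSeparate A) (π : Bivec A) (α γ : Form1 A) :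
    π ![α, γ] = γ (sharp π α) :=
  hA.eq (T := fun γ => π ![α, γ]) (T' := fun γ => γ (sharp π α)) (alt_add_right π α)
    (fun f γ => alt_smul_right π f α γ) (fun _ _ => rfl) (fun _ _ => rfl) (fun _ => rfl) γ

lemma apply_sharp_swap (hA : ExactFormsSeparate A) (π : Bivec A) (α γ : Form1 A) :
    γ (sharp π α) = -α (sharp π γ) := by
  rw [← pairing_eq hA, ← pairing_eq hA, alt_swap_eq]

/-- Hamiltonian vector fields preserve the Poisson bivector. -/
lemma hamiltonian_preserves (hA : ExactFormsSeparate A) {π : Bivec A} (hπ : IsPoisson π) (h : A)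
    (α β : Form1 A) :
    sharp π (d0 h) (π ![α, β]) =
      β ⁅sharp π (d0 h), sharp π α⁆ - α ⁅sharp π (d0 h), sharp π β⁆ := by
  set H := sharp π (d0 h) with hH
  -- On differentials the claim is the Jacobi identity for f, g, h.
  have key : ∀ f g : A, H (π ![d0 f, d0 g]) =
      d0 g ⁅H, sharp π (d0 f)⁆ - d0 f ⁅H, sharp π (d0 g)⁆ := by
    intro f g
    have hJ := hπ f g h
    simp only [d0_apply, Derivation.commutator_apply, hH, sharp_apply]
    simp only [poissonBracket_apply] at hJ
    have e1 : π ![d0 h, d0 (π ![d0 g, d0 f])] = - π ![d0 h, d0 (π ![d0 f, d0 g])] := by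
      rw [alt_swap_eq π (d0 g) (d0 f), ← neg_one_smul ℝ (π ![d0 f, d0 g]), d0_smul,
        alt_smul_right]
      simp
    have e2 : π ![d0 f, d0 (π ![d0 h, d0 g])] = - π ![d0 f, d0 (π ![d0 g, d0 h])] := by
      rw [alt_swap_eq π (d0 h) (d0 g), ← neg_one_smul ℝ (π ![d0 g, d0 h]), d0_smul,
        alt_smul_right]
      simp
    linear_combination -hJ + e1 + e2
  -- Neither side is function-linear in α, but both produce the same extra term H(f) π(α,β), so the
  -- difference is.
  have extend : ∀ β : Form1 A, (∀ f, H (π ![d0 f, β]) =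
      β ⁅H, sharp π (d0 f)⁆ - d0 f ⁅H, sharp π β⁆) → ∀ α, H (π ![α, β]) =
      β ⁅H, sharp π α⁆ - α ⁅H, sharp π β⁆ := by
    intro β hβ α
    refine sub_eq_zero.1 (hA.eq (T := fun α => H (π ![α, β]) - (β ⁅H, sharp π α⁆ - α ⁅H, sharp π β⁆))
      (T' := fun _ => 0) ?_ ?_ (by simp) (by simp) (fun f => sub_eq_zero.2 (hβ f)) α)
    · intro α α'
      simp only [alt_add_left, sharp_add, lie_add, map_add, LinearMap.add_apply]; ring
    · intro f α
      simp only [sharp_smul, lie_smul_vec, map_add, map_smul, LinearMap.smul_apply,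
        Derivation.leibniz, smul_eq_mul, pairing_eq hA]; ring
  -- The claim is antisymmetric, so the extension in the first slot also serves the second.
  have swap : ∀ α β : Form1 A, H (π ![α, β]) = β ⁅H, sharp π α⁆ - α ⁅H, sharp π β⁆ →
      H (π ![β, α]) = α ⁅H, sharp π β⁆ - β ⁅H, sharp π α⁆ := by
    intro α β h
    rw [alt_swap_eq, map_neg, h]; ring
  exact swap _ _ (extend α (fun f => swap _ _ (extend (d0 f) (fun g => key g f) α)) β)

/-- The anchor is a homomorphism of Lie algebras. -/
lemma sharp_koszul (hA : ExactFormsSeparate A) {π : Bivec A} (hπ : IsPoisson π) (α β : Form1 A) :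
    sharp π (koszul π α β) = ⁅sharp π α, sharp π β⁆ := by
  ext h
  -- Tested on h, the identity becomes the invariance of π under the Hamiltonian field of h.
  have h1 := hamiltonian_preserves hA hπ h α β
  have e1 : ∀ γ : Form1 A, γ (sharp π (d0 h)) = -(sharp π γ h) := fun γ => by
    rw [apply_sharp_swap hA]; rfl
  rw [sharp_apply, alt_swap_eq, pairing_eq hA, koszul_apply, e1, e1, Derivation.commutator_apply, h1,
    ← lie_skew (sharp π (d0 h)) (sharp π α), ← lie_skew (sharp π (d0 h)) (sharp π β)]
  simp only [map_neg]
  ring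

lemma koszul_hamiltonian (π : Bivec A) (f : A) (ξ : Form1 A) :
    koszul π (d0 f) ξ = lieDeriv (sharp π (d0 f)) ξ := by
  ext1 Z
  rw [koszul_apply, lieDeriv_apply, d0_apply, d0_apply, Derivation.commutator_apply,
    alt_swap_eq, ← sharp_apply]
  simp

lemma koszul_exact (π : Bivec A) (f g : A) :
    koszul π (d0 f) (d0 g) = d0 (π ![d0 f, d0 g]) := by
  rw [koszul_hamiltonian]
  ext1 Z
  rw [lieDeriv_apply, d0_apply, d0_apply, d0_apply, Derivation.commutator_apply, sub_sub_cancel, sharp_apply]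

section Inverse

variable {π : Bivec A} {Om : Form2 A}

lemma flat_inverse_apply (hOm : IsInverse π Om) (α : Form1 A) (Y : Vec A) :
    Om ![sharp π α, Y] = α Y := by
  rw [← flat_apply, hOm.1]

lemma bivector_flat_flat (hA : ExactFormsSeparate A) (hOm : IsInverse π Om) (X Y : Vec A) :
    π ![flat Om X, flat Om Y] = Om ![Y, X] := by
  rw [pairing_eq hA, hOm.2, flat_apply]

/-- The inverse of a Poisson bivector is closed. -/
lemma form_closed (hA : ExactFormsSeparate A) (hπ : IsPoisson π) (hOm : IsInverse π Om)
    (X Y Z : Vec A) :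
    Om ![⁅X, Y⁆, Z] = X (Om ![Y, Z]) - Om ![Y, ⁅X, Z⁆] - (Y (Om ![X, Z]) - Om ![X, ⁅Y, Z⁆])
      - Z (Om ![Y, X]) := by
  -- Closedness of ω is the homomorphism property of the anchor, read through ω.
  have h := sharp_koszul hA hπ (flat Om X) (flat Om Y)
  rw [hOm.2, hOm.2] at h
  rw [← h, flat_inverse_apply hOm, koszul_apply, hOm.2, hOm.2, bivector_flat_flat hA hOm]
  rfl

end Inverse

namespace ContravariantConnection

variable {π : Bivec A} (D : ContravariantConnection π)

lemma onVec_apply (α : Form1 A) (X : Vec A) (f : A) :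
    D.onVec α X f = sharp π α (X f) - D.toFun α (d0 f) X := rfl

lemma onForm2_apply (α : Form1 A) (σ : Form2 A) (X Y : Vec A) :
    D.onForm2 α σ ![X, Y] =
      sharp π α (σ ![X, Y]) - σ ![D.onVec α X, Y] - σ ![X, D.onVec α Y] := rfl

/-- The pairing of `D_α X` with 1-forms. -/
lemma apply_onVec (hA : ExactFormsSeparate A) (α β : Form1 A) (X : Vec A) :
    β (D.onVec α X) = sharp π α (β X) - D.toFun α β X := by
  refine hA.eq (T := fun β => β (D.onVec α X)) (T' := fun β => sharp π α (β X) - D.toFun α β X)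
    (fun _ _ => rfl) (fun _ _ => rfl) ?_ ?_ (fun _ => rfl) β
  · intro β β'
    simp only [D.add_right, LinearMap.add_apply, map_add]; ring
  · intro f β
    simp only [D.leibniz, LinearMap.add_apply, LinearMap.smul_apply, smul_eq_mul,
      Derivation.leibniz]; ring

lemma onVec_add_left (α α' : Form1 A) (X : Vec A) :
    D.onVec (α + α') X = D.onVec α X + D.onVec α' X := by
  ext f
  simp only [onVec_apply, sharp_add, D.add_left, LinearMap.add_apply, Derivation.add_apply]; ring

lemma onVec_smul_left (f : A) (α : Form1 A) (X : Vec A) :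
    D.onVec (f • α) X = f • D.onVec α X := by
  ext g
  simp only [onVec_apply, sharp_smul, D.smul_left, LinearMap.smul_apply, Derivation.smul_apply,
    smul_eq_mul]; ring

lemma onForm2_add_left (α α' : Form1 A) (σ : Form2 A) :
    D.onForm2 (α + α') σ = D.onForm2 α σ + D.onForm2 α' σ := by
  refine alt_ext fun X Y => ?_
  simp only [AlternatingMap.add_apply, onForm2_apply, onVec_add_left, sharp_add, alt_add_left,
    alt_add_right, Derivation.add_apply]; ring

lemma onForm2_smul_left (f : A) (α : Form1 A) (σ : Form2 A) :
    D.onForm2 (f • α) σ = f • D.onForm2 α σ := by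
  refine alt_ext fun X Y => ?_
  simp only [AlternatingMap.smul_apply, onForm2_apply, onVec_smul_left, sharp_smul, alt_smul_left,
    alt_smul_right, Derivation.smul_apply, smul_eq_mul]; ring

lemma onForm2_add (α : Form1 A) (σ τ : Form2 A) :
    D.onForm2 α (σ + τ) = D.onForm2 α σ + D.onForm2 α τ := by
  refine alt_ext fun X Y => ?_
  simp only [AlternatingMap.add_apply, onForm2_apply, map_add]; ring

lemma onForm2_smul (α : Form1 A) (f : A) (σ : Form2 A) :
    D.onForm2 α (f • σ) = f • D.onForm2 α σ + sharp π α f • σ := by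
  refine alt_ext fun X Y => ?_
  simp only [AlternatingMap.smul_apply, AlternatingMap.add_apply, onForm2_apply, smul_eq_mul,
    Derivation.leibniz]; ring

lemma onForm2_sub_left (α α' : Form1 A) (σ : Form2 A) :
    D.onForm2 (α - α') σ = D.onForm2 α σ - D.onForm2 α' σ := by
  rw [eq_sub_iff_add_eq, ← D.onForm2_add_left, sub_add_cancel]

/-- Flatness passes to the dual connection by the product rule for the pairing, because on functions
the commutator of #α and #β is the anchor of the Koszul bracket. -/
lemma onVec_commutator (hA : ExactFormsSeparate A) (hπ : IsPoisson π) (hflat : D.IsFlat)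
    (α β : Form1 A) (X : Vec A) :
    D.onVec α (D.onVec β X) - D.onVec β (D.onVec α X) = D.onVec (koszul π α β) X := by
  ext f
  have h := LinearMap.congr_fun (hflat α β (d0 f)) X
  simp only [LinearMap.sub_apply, LinearMap.zero_apply] at h
  simp only [Derivation.sub_apply, onVec_apply, sharp_koszul hA hπ, Derivation.commutator_apply,
    D.apply_onVec hA, map_sub]
  linear_combination -h

lemma onForm2_commutator (hA : ExactFormsSeparate A) (hπ : IsPoisson π) (hflat : D.IsFlat)
    (α β : Form1 A) (σ : Form2 A) :
    D.onForm2 α (D.onForm2 β σ) - D.onForm2 β (D.onForm2 α σ) = D.onForm2 (koszul π α β) σ := by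
  refine alt_ext fun X Y => ?_
  simp only [AlternatingMap.sub_apply, onForm2_apply, ← D.onVec_commutator hA hπ hflat,
    sharp_koszul hA hπ, Derivation.commutator_apply, map_sub, alt_sub_left, alt_sub_right]
  ring

lemma toFun_sub_swap (htf : D.IsTorsionFree) (α β : Form1 A) :
    D.toFun α β - D.toFun β α = koszul π α β := sub_eq_zero.1 (htf α β)

lemma toFun_commutator (hflat : D.IsFlat) (α β γ : Form1 A) :
    D.toFun α (D.toFun β γ) - D.toFun β (D.toFun α γ) = D.toFun (koszul π α β) γ :=
  sub_eq_zero.1 (hflat α β γ)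

/-- By flatness the commutator of D_α and D_β is D along the Koszul bracket; by torsion-freeness the
correction terms differ by exactly that. -/
lemma deriv2_symm (hA : ExactFormsSeparate A) (hπ : IsPoisson π) (hflat : D.IsFlat)
    (htf : D.IsTorsionFree) (σ : Form2 A) (α β : Form1 A) :
    D.deriv2 σ α β = D.deriv2 σ β α := by
  have h := D.onForm2_commutator hA hπ hflat α β σ
  rw [← D.toFun_sub_swap htf, onForm2_sub_left] at h
  simp only [deriv2]
  rw [sub_eq_sub_iff_add_eq_add] at h ⊢
  rw [h, add_comm]

lemma deriv2_add_left (σ : Form2 A) (β β' γ : Form1 A) :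
    D.deriv2 σ (β + β') γ = D.deriv2 σ β γ + D.deriv2 σ β' γ := by
  simp only [deriv2, onForm2_add_left, D.add_left]; abel

lemma deriv2_smul_left (σ : Form2 A) (f : A) (β γ : Form1 A) :
    D.deriv2 σ (f • β) γ = f • D.deriv2 σ β γ := by
  simp only [deriv2, onForm2_smul_left, D.smul_left, smul_sub]

lemma deriv2_add_right (σ : Form2 A) (β γ γ' : Form1 A) :
    D.deriv2 σ β (γ + γ') = D.deriv2 σ β γ + D.deriv2 σ β γ' := by
  simp only [deriv2, onForm2_add_left, D.add_right, onForm2_add]; abel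

lemma deriv2_smul_right (σ : Form2 A) (f : A) (β γ : Form1 A) :
    D.deriv2 σ β (f • γ) = f • D.deriv2 σ β γ := by
  simp only [deriv2, onForm2_smul_left, D.leibniz, onForm2_smul, onForm2_add_left, smul_sub]; abel

/-- The third contravariant derivative of a 2-form as a trilinear map. -/
def deriv3Linear (σ : Form2 A) : Form1 A →ₗ[A] Form1 A →ₗ[A] Form1 A →ₗ[A] Form2 A :=
  LinearMap.mk₂ A
    (fun α β =>
      { toFun := fun γ => D.deriv3 σ α β γ
        map_add' := fun γ γ' => by
          simp only [deriv3, deriv2_add_right, D.add_right, onForm2_add]; abel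
        map_smul' := fun f γ => by
          simp only [deriv3, deriv2_smul_right, D.leibniz, onForm2_smul, deriv2_add_right, smul_sub,
            RingHom.id_apply]
          abel })
    (by
      intro α α' β; ext1 γ
      change D.deriv3 _ _ _ _ = D.deriv3 _ _ _ _ + D.deriv3 _ _ _ _
      simp only [deriv3, onForm2_add_left, D.add_left, deriv2_add_left, deriv2_add_right]; abel)
    (by
      intro f α β; ext1 γ
      change D.deriv3 _ _ _ _ = f • D.deriv3 _ _ _ _
      simp only [deriv3, onForm2_smul_left, D.smul_left, deriv2_smul_left, deriv2_smul_right,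
        smul_sub])
    (by
      intro α β β'; ext1 γ
      change D.deriv3 _ _ _ _ = D.deriv3 _ _ _ _ + D.deriv3 _ _ _ _
      simp only [deriv3, D.add_right, deriv2_add_left, onForm2_add]; abel)
    (by
      intro f α β; ext1 γ
      change D.deriv3 _ _ _ _ = f • D.deriv3 _ _ _ _
      simp only [deriv3, D.leibniz, deriv2_smul_left, deriv2_add_left, onForm2_smul, smul_sub]
      abel)

lemma deriv3Linear_apply (σ : Form2 A) (α β γ : Form1 A) :
    D.deriv3Linear σ α β γ = D.deriv3 σ α β γ := rfl

end ContravariantConnection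

end Algebraic


/-! ### The bracket of 1-forms and the metacurvature -/

section Algebraic

variable {A : Type*} [CommRing A] [Algebra ℝ A]

namespace ContravariantConnection

variable {π : Bivec A} {Om : Form2 A} (D : ContravariantConnection π)

/-- The exterior derivative in terms of a torsion-free contravariant connection. -/
lemma d1_eq (hA : ExactFormsSeparate A) (hπ : IsPoisson π) (hOm : IsInverse π Om)
    (htf : D.IsTorsionFree) (α : Form1 A) (X Y : Vec A) :
    d1 α ![X, Y] = D.toFun (flat Om X) α Y - D.toFun (flat Om Y) α X
      - D.onForm2 α Om ![X, Y] := by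
  have h1 := LinearMap.congr_fun (D.toFun_sub_swap htf (flat Om X) α) Y
  have h2 := LinearMap.congr_fun (D.toFun_sub_swap htf (flat Om Y) α) X
  simp only [LinearMap.sub_apply, koszul_apply, pairing_eq hA, hOm.2, flat_apply] at h1 h2
  -- Torsion-freeness leaves the Lie brackets of #α with X and Y inside ω; closedness of ω on (#α,
  -- X, Y) removes them.
  have h3 := form_closed hA hπ hOm (sharp π α) X Y
  have e1 : Om ![D.onVec α X, Y] = -(sharp π α (Om ![Y, X]) - D.toFun α (flat Om Y) X) := by
    rw [alt_swap_eq, ← flat_apply Om Y, D.apply_onVec hA]; rfl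
  have e2 : Om ![X, D.onVec α Y] = sharp π α (Om ![X, Y]) - D.toFun α (flat Om X) Y := by
    rw [← flat_apply Om X, D.apply_onVec hA]; rfl
  rw [flat_inverse_apply hOm, flat_inverse_apply hOm, alt_swap_eq Om X (sharp π α),
    flat_inverse_apply hOm, alt_swap_eq Om ⁅sharp π α, X⁆ Y] at h3
  have e3 : Om ![Y, X] = - Om ![X, Y] := alt_swap_eq _ _ _
  have e4 : α ⁅Y, X⁆ = - α ⁅X, Y⁆ := by rw [← lie_skew, map_neg]
  rw [onForm2_apply, e1, e2, d1_apply]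
  simp only [e3, e4, map_neg] at h1 h2 h3 ⊢
  linear_combination -h1 + h2 - h3

/-- The 1-form `Z ↦ (D_{ω(Z, ·)} α)(X)`. -/
def gradForm (Om : Form2 A) (α : Form1 A) (X : Vec A) : Form1 A where
  toFun Z := D.toFun (flat Om Z) α X
  map_add' Z Z' := by rw [flat_add, D.add_left]; rfl
  map_smul' f Z := by rw [flat_smul, D.smul_left]; rfl

lemma gradForm_apply (α : Form1 A) (X Z : Vec A) :
    D.gradForm Om α X Z = D.toFun (flat Om Z) α X := rfl

lemma gradForm_add (α : Form1 A) (X X' : Vec A) :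
    D.gradForm Om α (X + X') = D.gradForm Om α X + D.gradForm Om α X' :=
  LinearMap.ext fun Z => map_add (D.toFun (flat Om Z) α) X X'

lemma gradForm_smul (α : Form1 A) (f : A) (X : Vec A) :
    D.gradForm Om α (f • X) = f • D.gradForm Om α X :=
  LinearMap.ext fun Z => map_smul (D.toFun (flat Om Z) α) f X

lemma gradForm_add_left (α α' : Form1 A) (X : Vec A) :
    D.gradForm Om (α + α') X = D.gradForm Om α X + D.gradForm Om α' X := by
  ext1 Z
  simp only [gradForm_apply, D.add_right, LinearMap.add_apply]

lemma gradForm_smul_left (hOm : IsInverse π Om) (f : A) (α : Form1 A) (X : Vec A) :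
    D.gradForm Om (f • α) X = f • D.gradForm Om α X + α X • d0 f := by
  ext1 Z
  simp only [gradForm_apply, D.leibniz, LinearMap.add_apply, LinearMap.smul_apply, hOm.2, d0_apply,
    smul_eq_mul]
  ring

/-- The 2-form `∑ {aⁱ, bʲ} θᵢ ∧ θⱼ`, for `α = ∑ aⁱ θᵢ` and `β = ∑ bʲ θⱼ` in a local frame of
`D`-parallel 1-forms `θᵢ`. -/
def gradBracket (Om : Form2 A) (α β : Form1 A) : Form2 A :=
  mkAlt (LinearMap.mk₂ A
    (fun X Y => π ![D.gradForm Om α X, D.gradForm Om β Y]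
      - π ![D.gradForm Om α Y, D.gradForm Om β X])
    (by intro X X' Y; simp only [gradForm_add, alt_add_left, alt_add_right]; ring)
    (by intro f X Y; simp only [gradForm_smul, alt_smul_left, alt_smul_right, smul_eq_mul]; ring)
    (by intro X Y Y'; simp only [gradForm_add, alt_add_left, alt_add_right]; ring)
    (by intro f X Y; simp only [gradForm_smul, alt_smul_left, alt_smul_right, smul_eq_mul]; ring))
    (by intro X; simp)

lemma gradBracket_apply (α β : Form1 A) (X Y : Vec A) :
    D.gradBracket Om α β ![X, Y] = π ![D.gradForm Om α X, D.gradForm Om β Y]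
      - π ![D.gradForm Om α Y, D.gradForm Om β X] := rfl

/-- The generalized Poisson bracket of 1-forms on a symplectic manifold. -/
def formBracket (Om : Form2 A) (α β : Form1 A) : Form2 A :=
  D.deriv2 Om α β + D.gradBracket Om α β

lemma gradBracket_symm (α β : Form1 A) : D.gradBracket Om α β = D.gradBracket Om β α := by
  refine alt_ext fun X Y => ?_
  rw [gradBracket_apply, gradBracket_apply, alt_swap_eq π (D.gradForm Om β X),
    alt_swap_eq π (D.gradForm Om β Y)]
  ring

/-- In a parallel frame D_{df} acts on coefficients as the Hamiltonian field H of f, and d(H b) =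
L_H(db). Invariantly this is flatness for the pair df, ω(Z,·), whose Koszul bracket is ω([H,Z],·).
-/
lemma gradForm_hamiltonian (hA : ExactFormsSeparate A) (hπ : IsPoisson π) (hOm : IsInverse π Om)
    (hflat : D.IsFlat) (f : A) (β : Form1 A) (X : Vec A) :
    D.gradForm Om (D.toFun (d0 f) β) X =
      lieDeriv (sharp π (d0 f)) (D.gradForm Om β X) - D.gradForm Om β (D.onVec (d0 f) X) := by
  ext1 Z
  have h := LinearMap.congr_fun (D.toFun_commutator hflat (d0 f) (flat Om Z) β) X
  have hk : koszul π (d0 f) (flat Om Z) = flat Om ⁅sharp π (d0 f), Z⁆ := by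
    rw [← hOm.1 (koszul π (d0 f) (flat Om Z)), sharp_koszul hA hπ, hOm.2]
  rw [hk] at h
  simp only [LinearMap.sub_apply] at h
  simp only [LinearMap.sub_apply, lieDeriv_apply, gradForm_apply, D.apply_onVec hA]
  linear_combination -h

/-- Torsion-freeness for df and dg, in vector form. It turns the gradient terms of {df, α} into the
Lie brackets and dual derivatives that occur in the Leibniz identity. -/
lemma sharp_gradForm_exact (hA : ExactFormsSeparate A) (hOm : IsInverse π Om)
    (htf : D.IsTorsionFree) (f : A) (X : Vec A) :
    sharp π (D.gradForm Om (d0 f) X) = ⁅X, sharp π (d0 f)⁆ + D.onVec (d0 f) X := by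
  ext g
  have h := LinearMap.congr_fun (D.toFun_sub_swap htf (d0 f) (d0 g)) X
  rw [koszul_exact] at h
  simp only [LinearMap.sub_apply, d0_apply] at h
  rw [sharp_apply, alt_swap_eq, pairing_eq hA, gradForm_apply, hOm.1]
  simp only [Derivation.add_apply, Derivation.commutator_apply, onVec_apply, sharp_apply]
  linear_combination h

/-- Replacing α by fα adds α(X) df to `gradForm`, which produces the wedge term, while D²ω is
tensorial. For the Leibniz identity each exterior derivative is expanded by `d1_eq`: the terms in Dω
combine to D²ω(df, α), the others to the gradient bracket. -/
lemma isFormBracket_formBracket (hA : ExactFormsSeparate A) (hπ : IsPoisson π)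
    (hOm : IsInverse π Om) (hflat : D.IsFlat) (htf : D.IsTorsionFree) :
    D.IsFormBracket (D.formBracket Om) where
  symm α β := by
    rw [formBracket, formBracket, D.deriv2_symm hA hπ hflat htf, gradBracket_symm]
  add_left α α' β := by
    refine alt_ext fun X Y => ?_
    simp only [formBracket, deriv2_add_left, AlternatingMap.add_apply, gradBracket_apply,
      gradForm_add_left, alt_add_left]
    ring
  product f α β := by
    refine alt_ext fun X Y => ?_
    simp only [formBracket, deriv2_smul_left, AlternatingMap.add_apply, AlternatingMap.smul_apply,
      gradBracket_apply, D.gradForm_smul_left hOm, alt_add_left, alt_smul_left, wedge_apply,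
      smul_eq_mul, pairing_eq hA π (d0 f), gradForm_apply, hOm.1]
    ring
  leibniz f α := by
    refine alt_ext fun X Y => ?_
    rw [AlternatingMap.add_apply, D.d1_eq hA hπ hOm htf, D.onForm2_apply (d0 f) (d1 α), D.d1_eq hA hπ hOm htf, D.d1_eq hA hπ hOm htf,
      D.d1_eq hA hπ hOm htf, formBracket, AlternatingMap.add_apply, deriv2, AlternatingMap.sub_apply,
      onForm2_apply D (d0 f) (D.onForm2 α Om), gradBracket_apply]
    rw [pairing_eq hA, pairing_eq hA, D.sharp_gradForm_exact hA hOm htf,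
      D.sharp_gradForm_exact hA hOm htf]
    have hX := LinearMap.congr_fun (D.gradForm_hamiltonian hA hπ hOm hflat f α Y) X
    have hY := LinearMap.congr_fun (D.gradForm_hamiltonian hA hπ hOm hflat f α X) Y
    simp only [LinearMap.sub_apply, lieDeriv_apply, ← gradForm_apply (Om := Om)] at hX hY ⊢
    have e1 : ∀ Z W, D.gradForm Om α W ⁅Z, sharp π (d0 f)⁆ =
        - D.gradForm Om α W ⁅sharp π (d0 f), Z⁆ := fun Z W => by rw [← lie_skew, map_neg]
    simp only [map_add, map_sub, e1]
    linear_combination hX - hY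

/-- The frame is parallel and Hamiltonian fields are derivations of the Poisson bracket: `key` says
that the Lie derivative of π along #df vanishes. -/
lemma onForm2_gradBracket (hA : ExactFormsSeparate A) (hπ : IsPoisson π)
    (hOm : IsInverse π Om) (hflat : D.IsFlat) (f : A) (β γ : Form1 A) :
    D.onForm2 (d0 f) (D.gradBracket Om β γ) =
      D.gradBracket Om (D.toFun (d0 f) β) γ + D.gradBracket Om β (D.toFun (d0 f) γ) := by
  have key : ∀ ξ η : Form1 A, sharp π (d0 f) (π ![ξ, η]) =
      π ![lieDeriv (sharp π (d0 f)) ξ, η] + π ![ξ, lieDeriv (sharp π (d0 f)) η] := by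
    intro ξ η
    rw [hamiltonian_preserves hA hπ, ← sharp_koszul hA hπ, koszul_hamiltonian,
      ← sharp_koszul hA hπ, koszul_hamiltonian, ← pairing_eq hA, ← pairing_eq hA,
      alt_swap_eq π ξ]
    ring
  refine alt_ext fun X Y => ?_
  simp only [AlternatingMap.add_apply, onForm2_apply, gradBracket_apply,
    D.gradForm_hamiltonian hA hπ hOm hflat, map_sub, alt_sub_left, alt_sub_right, key]
  ring

/-- The gradient parts cancel by the derivation property, so only derivatives of D²ω survive. -/
lemma deriv3_eq_formBracket (hA : ExactFormsSeparate A) (hπ : IsPoisson π)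
    (hOm : IsInverse π Om) (hflat : D.IsFlat) (htf : D.IsTorsionFree) (f : A) (β γ : Form1 A) :
    D.deriv3 Om (d0 f) β γ = D.onForm2 (d0 f) (D.formBracket Om β γ)
      - D.formBracket Om (D.toFun (d0 f) β) γ - D.formBracket Om (D.toFun (d0 f) γ) β := by
  rw [(D.isFormBracket_formBracket hA hπ hOm hflat htf).symm (D.toFun (d0 f) γ) β]
  simp only [formBracket, onForm2_add, D.onForm2_gradBracket hA hπ hOm hflat, deriv3]
  abel

lemma isMetacurvature_deriv3Linear (hA : ExactFormsSeparate A) (hπ : IsPoisson π)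
    (hOm : IsInverse π Om) (hflat : D.IsFlat) (htf : D.IsTorsionFree) :
    D.IsMetacurvature (D.deriv3Linear Om) :=
  ⟨D.formBracket Om, D.isFormBracket_formBracket hA hπ hOm hflat htf,
    fun f β γ => D.deriv3_eq_formBracket hA hπ hOm hflat htf f β γ⟩

variable {D}

/-- The product identity has the same inhomogeneous term for both brackets, so their difference is
function-linear in α; the Leibniz identity prescribes it on differentials. -/
lemma IsFormBracket.unique (hA : ExactFormsSeparate A) {B B' : Form1 A → Form1 A → Form2 A}
    (hB : D.IsFormBracket B) (hB' : D.IsFormBracket B') : B = B' := by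
  ext1 α; ext1 β
  refine alt_ext fun X Y => sub_eq_zero.1 ?_
  refine hA.eq (T := fun α => B α β ![X, Y] - B' α β ![X, Y]) (T' := fun _ => 0) ?_ ?_ (by simp)
    (by simp) ?_ α
  · intro α α'
    simp only [hB.add_left, hB'.add_left, AlternatingMap.add_apply]; ring
  · intro f α
    simp only [hB.product, hB'.product, AlternatingMap.add_apply, AlternatingMap.smul_apply,
      smul_eq_mul]
    ring
  · intro f
    have h := (hB.leibniz f β).symm.trans (hB'.leibniz f β)
    rw [add_right_cancel h, sub_self]

lemma IsMetacurvature.unique (hA : ExactFormsSeparate A)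
    {Mc Mc' : Form1 A →ₗ[A] Form1 A →ₗ[A] Form1 A →ₗ[A] Form2 A}
    (h : D.IsMetacurvature Mc) (h' : D.IsMetacurvature Mc') : Mc = Mc' := by
  obtain ⟨B, hB, hM⟩ := h
  obtain ⟨B', hB', hM'⟩ := h'
  obtain rfl := hB.unique hA hB'
  ext1 α; ext1 β; ext1 γ
  refine alt_ext fun X Y => ?_
  refine hA.eq (T := fun α => Mc α β γ ![X, Y]) (T' := fun α => Mc' α β γ ![X, Y]) ?_ ?_ ?_ ?_ ?_ α
  · intro α α'; simp
  · intro f α; simp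
  · intro α α'; simp
  · intro f α; simp
  · intro f; simp only [hM, hM']

end ContravariantConnection

/-! ### The associated affine connection, and lowering indices with ω -/

section Associated

variable {π : Bivec A} {Om : Form2 A} (D : ContravariantConnection π)

/-- The affine connection `∇_X Y = # D_{ω(X, ·)} ω(Y, ·)`. -/
def associatedConnection (hOm : IsInverse π Om) : AffineConnection A where
  toFun X Y := sharp π (D.toFun (flat Om X) (flat Om Y))
  add_left X X' Y := by rw [flat_add, D.add_left, sharp_add]
  smul_left f X Y := by rw [flat_smul, D.smul_left, sharp_smul]
  add_right X Y Y' := by rw [flat_add, D.add_right, sharp_add]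
  leibniz X f Y := by
    rw [flat_smul, D.leibniz, sharp_add, sharp_smul, sharp_smul, hOm.2, hOm.2]

lemma isAssociated_associatedConnection (hOm : IsInverse π Om) :
    IsAssociated D (associatedConnection D hOm) := fun α β => by
  simp only [associatedConnection, hOm.1]

variable {D} {nabla : AffineConnection A}

lemma IsAssociated.eq_associatedConnection (h : IsAssociated D nabla) (hOm : IsInverse π Om) :
    nabla = associatedConnection D hOm := by
  ext1; ext1 X; ext1 Y
  simp only [associatedConnection, h _ _, hOm.2]

lemma IsAssociated.isFlat (h : IsAssociated D nabla) (hA : ExactFormsSeparate A)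
    (hπ : IsPoisson π) (hOm : IsInverse π Om) (hflat : D.IsFlat) : nabla.IsFlat := by
  intro X Y Z
  rw [← hOm.2 X, ← hOm.2 Y, ← hOm.2 Z, ← sharp_koszul hA hπ]
  simp only [← h _ _]
  rw [← sharp_sub, ← sharp_sub, hflat, sharp_zero]

lemma IsAssociated.isTorsionFree (h : IsAssociated D nabla) (hA : ExactFormsSeparate A)
    (hπ : IsPoisson π) (hOm : IsInverse π Om) (htf : D.IsTorsionFree) : nabla.IsTorsionFree := by
  intro X Y
  rw [← hOm.2 X, ← hOm.2 Y, ← sharp_koszul hA hπ]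
  simp only [← h _ _]
  rw [← sharp_sub, ← sharp_sub, htf, sharp_zero]

/-- D on 1-forms corresponds to ∇ on vector fields, so the dual of D on vector fields corresponds to
the dual of ∇ on 1-forms. For this reason derivatives of ω under D become derivatives of π, not of
ω, under ∇. -/
lemma IsAssociated.flat_onVec (h : IsAssociated D nabla) (hA : ExactFormsSeparate A)
    (hOm : IsInverse π Om) (α : Form1 A) (X : Vec A) :
    flat Om (D.onVec α X) = nabla.onForm1 (sharp π α) (flat Om X) := by
  ext1 Y
  obtain ⟨η, rfl⟩ : ∃ η, sharp π η = Y := ⟨_, hOm.2 Y⟩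
  change Om ![_, _] = sharp π α (Om ![_, _]) - Om ![_, _]
  rw [← h, alt_swap_eq, flat_inverse_apply hOm, D.apply_onVec hA, alt_swap_eq Om X,
    flat_inverse_apply hOm, alt_swap_eq Om X, flat_inverse_apply hOm, map_neg]
  ring

lemma AffineConnection.onBivec_apply (X : Vec A) (P : Bivec A) (α β : Form1 A) :
    nabla.onBivec X P ![α, β] =
      X (P ![α, β]) - P ![nabla.onForm1 X α, β] - P ![α, nabla.onForm1 X β] := rfl

/-- The 2-form `-P(ω(X, ·), ω(Y, ·))`. -/
def lowerBivec (Om : Form2 A) (P : Bivec A) : Form2 A :=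
  mkAlt (LinearMap.mk₂ A (fun X Y => -P ![flat Om X, flat Om Y])
    (by intro X X' Y; simp only [flat_add, alt_add_left]; ring)
    (by intro f X Y; simp only [flat_smul, alt_smul_left, smul_eq_mul]; ring)
    (by intro X Y Y'; simp only [flat_add, alt_add_right]; ring)
    (by intro f X Y; simp only [flat_smul, alt_smul_right, smul_eq_mul]; ring))
    (by intro X; simp [alt_self])

lemma lowerBivec_apply (P : Bivec A) (X Y : Vec A) :
    lowerBivec Om P ![X, Y] = -P ![flat Om X, flat Om Y] := rfl

lemma lowerBivec_sub (P Q : Bivec A) :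
    lowerBivec Om (P - Q) = lowerBivec Om P - lowerBivec Om Q := by
  refine alt_ext fun X Y => ?_
  simp only [AlternatingMap.sub_apply, lowerBivec_apply]; ring

/-- The sign in `lowerBivec` is there for this, since π(ω(X,·), ω(Y,·)) = ω(Y,X). -/
lemma lowerBivec_self (hA : ExactFormsSeparate A) (hOm : IsInverse π Om) :
    lowerBivec Om π = Om := by
  refine alt_ext fun X Y => ?_
  rw [lowerBivec_apply, bivector_flat_flat hA hOm, ← alt_swap_eq]

lemma IsAssociated.onForm2_lowerBivec (h : IsAssociated D nabla) (hA : ExactFormsSeparate A)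
    (hOm : IsInverse π Om) (α : Form1 A) (P : Bivec A) :
    D.onForm2 α (lowerBivec Om P) = lowerBivec Om (nabla.onBivec (sharp π α) P) := by
  refine alt_ext fun X Y => ?_
  simp only [D.onForm2_apply, lowerBivec_apply, AffineConnection.onBivec_apply,
    h.flat_onVec hA hOm, map_neg]
  ring

lemma IsAssociated.deriv3_eq (h : IsAssociated D nabla) (hA : ExactFormsSeparate A)
    (hOm : IsInverse π Om) (α β γ : Form1 A) :
    D.deriv3 Om α β γ =
      lowerBivec Om (nabla.deriv3 π (sharp π α) (sharp π β) (sharp π γ)) := by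
  have h2 : ∀ β γ, D.deriv2 Om β γ =
      lowerBivec Om (nabla.deriv2 π (sharp π β) (sharp π γ)) := by
    intro β γ
    rw [ContravariantConnection.deriv2, AffineConnection.deriv2, lowerBivec_sub, ← h β γ,
      ← h.onForm2_lowerBivec hA hOm, ← h.onForm2_lowerBivec hA hOm, ← h.onForm2_lowerBivec hA hOm,
      lowerBivec_self hA hOm]
  rw [ContravariantConnection.deriv3, AffineConnection.deriv3, lowerBivec_sub, lowerBivec_sub,
    ← h α β, ← h α γ, ← h2, ← h2, ← h.onForm2_lowerBivec hA hOm, ← h2]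

end Associated

end Algebraic


/-! ### The Frobenius theorem for linear total differential equations -/

section TotalDifferential

set_option maxSynthPendingDepth 3

open Set Metric

variable {E F : Type*} [NormedAddCommGroup E] [NormedSpace ℝ E]
  [NormedAddCommGroup F] [NormedSpace ℝ F]

lemma smul_mem_ball_zero {r t : ℝ} {x : E} (ht : t ∈ Icc (0 : ℝ) 1) (hx : x ∈ ball (0 : E) r) :
    t • x ∈ ball (0 : E) r := by
  rw [mem_ball_zero_iff] at hx ⊢
  calc ‖t • x‖ = t * ‖x‖ := by rw [norm_smul, Real.norm_of_nonneg ht.1]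
    _ ≤ 1 * ‖x‖ := by gcongr; exact ht.2
    _ < r := by rwa [one_mul]

/-- Solutions along rays of the linear total differential equation `dζ = Γ ζ`. -/
lemma exists_radial_solution [CompleteSpace F] {Γ : E → E →L[ℝ] F →L[ℝ] F} {r K : ℝ}
    (hK0 : 0 ≤ K) (hK : ∀ x ∈ ball (0 : E) r, ‖Γ x‖ ≤ K) (hc : ContinuousOn Γ (ball 0 r))
    (hr : 2 * (K * r) ≤ 1) (ζ₀ : F) {x : E} (hx : x ∈ ball (0 : E) r) :
    ∃ α : ℝ → F, α 0 = ζ₀ ∧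
      ∀ t ∈ Icc (0 : ℝ) 1, HasDerivWithinAt α (Γ (t • x) x (α t)) (Icc 0 1) t := by
  have hr0 : 0 ≤ r := (norm_nonneg x).trans (mem_ball_zero_iff.1 hx).le
  have hΓ : ∀ t ∈ Icc (0 : ℝ) 1, ‖Γ (t • x) x‖ ≤ K * r := fun t ht =>
    ((Γ (t • x)).le_opNorm x).trans (mul_le_mul (hK _ (smul_mem_ball_zero ht hx))
      (mem_ball_zero_iff.1 hx).le (norm_nonneg _) hK0)
  have hKr : 0 ≤ K * r := mul_nonneg hK0 hr0
  -- On the ball of radius ‖ζ₀‖ about ζ₀ one has ‖ζ‖ ≤ 2‖ζ₀‖, so the speed is at most 2Kr‖ζ₀‖ ≤ ‖ζ₀‖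
  -- and the solution stays in the ball for the whole unit of time.
  have hf : IsPicardLindelof (fun t ζ => Γ (t • x) x ζ) (⟨0, by simp⟩ : Icc (0 : ℝ) 1) ζ₀
      ‖ζ₀‖₊ 0 ‖ζ₀‖₊ ⟨K * r, hKr⟩ := by
    refine ⟨fun t ht => ?_, fun ζ _ => ?_, fun t ht ζ hζ => ?_, by simp⟩
    · refine ((Γ (t • x) x).lipschitz.weaken ?_).lipschitzOnWith
      exact hΓ t ht
    · have h1 : ContinuousOn (fun t : ℝ => Γ (t • x)) (Icc 0 1) :=
        hc.comp (by fun_prop) (fun t ht => smul_mem_ball_zero ht hx)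
      exact (h1.clm_apply continuousOn_const).clm_apply continuousOn_const
    · have hn : ‖ζ‖ ≤ 2 * ‖ζ₀‖ := by
        rw [mem_closedBall, dist_eq_norm] at hζ
        have := norm_sub_norm_le ζ ζ₀
        simp only [coe_nnnorm] at hζ
        linarith
      calc ‖Γ (t • x) x ζ‖ ≤ ‖Γ (t • x) x‖ * ‖ζ‖ := (Γ (t • x) x).le_opNorm ζ
        _ ≤ (K * r) * (2 * ‖ζ₀‖) := mul_le_mul (hΓ t ht) hn (norm_nonneg _) hKr
        _ = (2 * (K * r)) * ‖ζ₀‖ := by ring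
        _ ≤ 1 * ‖ζ₀‖ := by gcongr
        _ = _ := by simp
  exact hf.exists_eq_forall_mem_Icc_hasDerivWithinAt₀

/-- The radial solutions of a flat linear total differential equation solve it in all
directions. -/
lemma hasFDerivAt_radial_solution {Γ : E → E →L[ℝ] F →L[ℝ] F}
    {Γ' : E → E →L[ℝ] E →L[ℝ] F →L[ℝ] F} {r K : ℝ} (hr1 : r ≤ 1) (hK0 : 0 < K)
    (hK : ∀ x ∈ ball (0 : E) r, ‖Γ x‖ ≤ K) (hK' : ∀ x ∈ ball (0 : E) r, ‖Γ' x‖ ≤ K)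
    (hΓ : ∀ x ∈ ball (0 : E) r, HasFDerivAt Γ (Γ' x) x)
    (hL : ∀ x ∈ ball (0 : E) r, ∀ y ∈ ball (0 : E) r, ‖Γ' x - Γ' y‖ ≤ K * ‖x - y‖)
    (hflat : ∀ x ∈ ball (0 : E) r, ∀ v w ζ,
      Γ' x v w ζ + Γ x w (Γ x v ζ) = Γ' x w v ζ + Γ x v (Γ x w ζ))
    {ζ₀ : F} {α : E → ℝ → F} (hα0 : ∀ x ∈ ball (0 : E) r, α x 0 = ζ₀)
    (hα : ∀ x ∈ ball (0 : E) r, ∀ t ∈ Icc (0 : ℝ) 1,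
      HasDerivWithinAt (α x) (Γ (t • x) x (α x t)) (Icc 0 1) t)
    {x : E} (hx : x ∈ ball (0 : E) r) :
    HasFDerivAt (fun y => α y 1) ((Γ x).flip (α x 1)) x := by
  obtain ⟨m, hm⟩ : ∃ m, ∀ t ∈ Icc (0 : ℝ) 1, ‖α x t‖ ≤ m :=
    isCompact_Icc.exists_bound_of_continuousOn (fun t ht => (hα x hx t ht).continuousWithinAt)
  have hm0 : 0 ≤ m := (norm_nonneg _).trans (hm 0 (by simp))
  -- The sum of the four error bounds `b1`, `b2`, `b3`, `b4` below, without the factor ‖v‖².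
  set C := (2 * K + 2 * K ^ 2) * m with hC
  have hC0 : 0 ≤ C := by positivity
  have main : ∀ y ∈ ball (0 : E) r, ‖α y 1 - (α x 1 + Γ x (y - x) (α x 1))‖ ≤
      (C / K * (Real.exp K - 1)) * ‖y - x‖ ^ 2 := by
    intro y hy
    obtain ⟨v, rfl⟩ : ∃ v, y = x + v := ⟨y - x, by simp⟩
    simp only [add_sub_cancel_left]
    have hy1 : ‖x + v‖ ≤ 1 := (mem_ball_zero_iff.1 hy).le.trans hr1
    -- First-order guess for the solution on the ray through x + v: a solution ζ would satisfy ζ(tx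
    -- + tv) ≈ ζ(tx) + Γ(tx)(tv)ζ(tx).
    set R : ℝ → F := fun t => α x t + t • Γ (t • x) v (α x t) with hR
    set R' : ℝ → F := fun t => Γ (t • x) x (α x t) + (t • (Γ' (t • x) x v (α x t)
      + Γ (t • x) v (Γ (t • x) x (α x t))) + Γ (t • x) v (α x t)) with hR'
    have hRd : ∀ t ∈ Icc (0 : ℝ) 1, HasDerivWithinAt R (R' t) (Icc 0 1) t := by
      intro t ht
      have h1 := hα x hx t ht
      have hlin : HasDerivWithinAt (fun t : ℝ => t • x) x (Icc 0 1) t := by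
        simpa using ((hasDerivAt_id t).smul_const x).hasDerivWithinAt
      have h2 : HasDerivWithinAt (fun t : ℝ => Γ (t • x)) (Γ' (t • x) x) (Icc 0 1) t :=
        (hΓ _ (smul_mem_ball_zero ht hx)).comp_hasDerivWithinAt t hlin
      have h3 : HasDerivWithinAt (fun t : ℝ => Γ (t • x) v (α x t)) _ (Icc 0 1) t :=
        (h2.clm_apply (hasDerivWithinAt_const t (Icc 0 1) v)).clm_apply h1
      have h4 := h1.add ((hasDerivWithinAt_id t (Icc 0 1)).smul h3)
      refine h4.congr_deriv ?_
      simp [hR']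
    have hmid : ∀ t ∈ Icc (0 : ℝ) 1, ‖R' t - Γ (t • (x + v)) (x + v) (R t)‖ ≤ C * ‖v‖ ^ 2 := by
      intro t ht
      have htx := smul_mem_ball_zero ht hx
      have hty := smul_mem_ball_zero ht hy
      have htv : ‖t • v‖ ≤ ‖v‖ := by
        rw [norm_smul, Real.norm_of_nonneg ht.1]
        exact mul_le_of_le_one_left (norm_nonneg _) ht.2
      have hseg : segment ℝ (t • x) (t • (x + v)) ⊆ ball (0 : E) r :=
        (convex_ball _ _).segment_subset htx hty
      have hd : t • (x + v) - t • x = t • v := by rw [smul_add, add_sub_cancel_left]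
      have hΔ : ‖Γ (t • (x + v)) - Γ (t • x) - Γ' (t • x) (t • v)‖ ≤ K * ‖v‖ ^ 2 := by
        have h := Convex.norm_image_sub_le_of_norm_hasFDerivWithin_le'
          (f := Γ) (f' := Γ') (s := segment ℝ (t • x) (t • (x + v))) (C := K * ‖v‖)
          (φ := Γ' (t • x)) (x := t • x) (y := t • (x + v))
          (fun z hz => (hΓ z (hseg hz)).hasFDerivWithinAt) ?_ (convex_segment _ _)
          (left_mem_segment _ _ _) (right_mem_segment _ _ _)
        · rw [hd] at h
          calc _ ≤ K * ‖v‖ * ‖t • v‖ := h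
            _ ≤ K * ‖v‖ * ‖v‖ := by gcongr
            _ = _ := by ring
        · intro z hz
          refine (hL z (hseg hz) _ htx).trans ?_
          gcongr
          have := norm_sub_le_of_mem_segment hz
          rw [hd] at this
          exact this.trans htv
      have hΔ' : ‖Γ (t • (x + v)) - Γ (t • x)‖ ≤ K * ‖v‖ := by
        have h := Convex.norm_image_sub_le_of_norm_hasFDerivWithin_le
          (f := Γ) (f' := Γ') (s := ball (0 : E) r) (C := K)
          (fun z hz => (hΓ z hz).hasFDerivWithinAt) hK' (convex_ball _ _) htx hty
        rw [hd] at h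
        exact h.trans (by gcongr)
      set a := α x t
      have ha : ‖a‖ ≤ m := hm t ht
      -- Flatness exchanges x and v in Γ'; then all terms of first order in v cancel, and each of
      -- the four remaining ones is quadratic.
      have hid : R' t - Γ (t • (x + v)) (x + v) (R t) =
          -(t • Γ' (t • x) v v a)
          - (Γ (t • (x + v)) - Γ (t • x) - Γ' (t • x) (t • v)) (x + v) a
          - t • Γ (t • x) v (Γ (t • x) v a)
          - t • (Γ (t • (x + v)) - Γ (t • x)) (x + v) (Γ (t • x) v a) := by
        have hf := hflat (t • x) htx x v a
        simp only [hR', hR]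
        rw [hf]
        simp only [_root_.sub_apply, map_add, map_smul, _root_.add_apply,
          _root_.smul_apply]
        module
      have ht1 : ‖t‖ ≤ 1 := by rw [Real.norm_of_nonneg ht.1]; exact ht.2
      have b1 : ‖t • Γ' (t • x) v v a‖ ≤ K * ‖v‖ ^ 2 * m := by
        calc _ ≤ 1 * (K * ‖v‖ * ‖v‖ * m) := by
              rw [norm_smul]
              gcongr
              exact (ContinuousLinearMap.le_of_opNorm_le _ (ContinuousLinearMap.le_of_opNorm_le _
                (ContinuousLinearMap.le_of_opNorm_le _ (hK' _ htx) v) v) a).trans (by gcongr)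
          _ = _ := by ring
      have b2 : ‖(Γ (t • (x + v)) - Γ (t • x) - Γ' (t • x) (t • v)) (x + v) a‖ ≤
          K * ‖v‖ ^ 2 * m := by
        refine (ContinuousLinearMap.le_of_opNorm_le _
          (ContinuousLinearMap.le_of_opNorm_le _ hΔ (x + v)) a).trans ?_
        calc _ ≤ K * ‖v‖ ^ 2 * 1 * m := by gcongr
          _ = _ := by ring
      have b3' : ‖Γ (t • x) v a‖ ≤ K * ‖v‖ * m :=
        (ContinuousLinearMap.le_of_opNorm_le _
          (ContinuousLinearMap.le_of_opNorm_le _ (hK _ htx) v) a).trans (by gcongr)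
      have b3 : ‖t • Γ (t • x) v (Γ (t • x) v a)‖ ≤ K ^ 2 * ‖v‖ ^ 2 * m := by
        calc _ ≤ 1 * (K * ‖v‖ * (K * ‖v‖ * m)) := by
              rw [norm_smul]
              gcongr
              exact (ContinuousLinearMap.le_of_opNorm_le _
                (ContinuousLinearMap.le_of_opNorm_le _ (hK _ htx) v) _).trans (by gcongr)
          _ = _ := by ring
      have b4 : ‖t • (Γ (t • (x + v)) - Γ (t • x)) (x + v) (Γ (t • x) v a)‖ ≤
          K ^ 2 * ‖v‖ ^ 2 * m := by
        calc _ ≤ 1 * (K * ‖v‖ * 1 * (K * ‖v‖ * m)) := by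
              rw [norm_smul]
              gcongr
              exact (ContinuousLinearMap.le_of_opNorm_le _
                (ContinuousLinearMap.le_of_opNorm_le _ hΔ' (x + v)) _).trans (by gcongr)
          _ = _ := by ring
      rw [hid]
      refine (norm_sub_le_of_le (norm_sub_le_of_le (norm_sub_le_of_le
        ((norm_neg _).trans_le b1) b2) b3) b4).trans (le_of_eq ?_)
      rw [hC]; ring
    have hIci : ∀ t ∈ Ico (0 : ℝ) 1, Icc (0 : ℝ) 1 ∈ 𝓝[Ici t] t := fun t ht =>
      Filter.mem_of_superset (Icc_mem_nhdsGE ht.2) (Icc_subset_Icc_left ht.1)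
    -- Gronwall: the exact trajectory for x + v and the approximate one R start at the same point,
    -- so at time 1 they differ by O(‖v‖²).
    have hG := dist_le_of_approx_trajectories_ODE_of_mem (a := 0) (b := 1)
      (K := ⟨K, hK0.le⟩) (s := fun _ => univ) (δ := 0) (εf := 0) (εg := C * ‖v‖ ^ 2)
      (v := fun t ζ => Γ (t • (x + v)) (x + v) ζ) (f := α (x + v)) (g := R)
      (f' := fun t => Γ (t • (x + v)) (x + v) (α (x + v) t)) (g' := R')
      (fun t ht => ((Γ (t • (x + v)) (x + v)).lipschitz.weaken (by
        have h := (Γ (t • (x + v))).le_opNorm (x + v)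
        have h' := hK _ (smul_mem_ball_zero (Ico_subset_Icc_self ht) hy)
        refine h.trans ?_
        calc _ ≤ K * 1 := by gcongr
          _ = K := mul_one K)).lipschitzOnWith)
      (fun t ht => (hα _ hy t ht).continuousWithinAt)
      (fun t ht => (hα _ hy t (Ico_subset_Icc_self ht)).mono_of_mem_nhdsWithin (hIci t ht))
      (fun t ht => by simp)
      (fun _ _ => mem_univ _)
      (fun t ht => (hRd t ht).continuousWithinAt)
      (fun t ht => (hRd t (Ico_subset_Icc_self ht)).mono_of_mem_nhdsWithin (hIci t ht))
      (fun t ht => by rw [dist_eq_norm]; exact hmid t (Ico_subset_Icc_self ht))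
      (fun _ _ => mem_univ _) (by simp [hR, hα0 _ hy, hα0 _ hx]) 1 (by simp)
    rw [dist_eq_norm, gronwallBound_of_K_ne_0 (by exact hK0.ne')] at hG
    simp only [hR, one_smul, zero_mul, zero_add, sub_zero, mul_one] at hG
    refine hG.trans (le_of_eq ?_)
    change C * ‖v‖ ^ 2 / K * (Real.exp K - 1) = _
    ring
  have hO : (fun y => α y 1 - (α x 1 + Γ x (y - x) (α x 1))) =O[𝓝 x] fun y => ‖y - x‖ ^ 2 := by
    refine Asymptotics.IsBigO.of_bound (C / K * (Real.exp K - 1)) ?_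
    filter_upwards [isOpen_ball.mem_nhds hx] with y hy
    simpa using main y hy
  have h0 : HasFDerivAt (fun y => α y 1 - (α x 1 + Γ x (y - x) (α x 1))) (0 : E →L[ℝ] F) x :=
    hO.hasFDerivAt (by norm_num)
  have h1 : HasFDerivAt (fun y => α x 1 + Γ x (y - x) (α x 1)) ((Γ x).flip (α x 1)) x := by
    have := ((((Γ x).flip (α x 1)).hasFDerivAt (x := x)).sub_const
      (Γ x x (α x 1))).const_add (α x 1)
    simpa using this
  have h2 := h0.add h1
  rw [zero_add] at h2
  exact h2.congr_of_eventuallyEq (Filter.Eventually.of_forall fun y => by simp)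

/-- **Frobenius theorem** for linear total differential equations. -/
theorem exists_solution_of_flat [CompleteSpace F] {Γ : E → E →L[ℝ] F →L[ℝ] F} {U : Set E}
    (hU : U ∈ 𝓝 (0 : E)) (hΓ : ContDiffOn ℝ ∞ Γ U)
    (hflat : ∀ x ∈ U, ∀ v w ζ, fderiv ℝ Γ x v w ζ + Γ x w (Γ x v ζ) =
      fderiv ℝ Γ x w v ζ + Γ x v (Γ x w ζ)) :
    ∃ r > 0, ball (0 : E) r ⊆ U ∧ ∀ ζ₀ : F, ∃ ζ : E → F, ζ 0 = ζ₀ ∧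
      (∀ x ∈ ball (0 : E) r, HasFDerivAt ζ ((Γ x).flip (ζ x)) x) ∧
      ContDiffOn ℝ ∞ ζ (ball 0 r) := by
  have hc : ContDiffAt ℝ ∞ Γ 0 := hΓ.contDiffAt hU
  have hc' : ContDiffAt ℝ 1 (fderiv ℝ Γ) 0 :=
    (hc.fderiv_right (m := 1) (by norm_cast))
  obtain ⟨K₁, s, hs, hLip⟩ := hc'.exists_lipschitzOnWith
  have hcont : ContinuousAt Γ 0 := hc.continuousAt
  have hcont' : ContinuousAt (fderiv ℝ Γ) 0 := hc'.continuousAt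
  set K : ℝ := max (max (‖Γ 0‖ + 1) (‖fderiv ℝ Γ 0‖ + 1)) K₁ with hKdef
  have hK1 : 1 ≤ K := le_max_of_le_left (le_max_of_le_left (by simp))
  have e1 : ∀ᶠ x in 𝓝 (0 : E), ‖Γ x‖ ≤ K :=
    (hcont.norm.eventually_lt continuousAt_const (lt_add_one _)).mono fun x hx =>
      hx.le.trans (le_max_of_le_left (le_max_left _ _))
  have e2 : ∀ᶠ x in 𝓝 (0 : E), ‖fderiv ℝ Γ x‖ ≤ K :=
    (hcont'.norm.eventually_lt continuousAt_const (lt_add_one _)).mono fun x hx =>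
      hx.le.trans (le_max_of_le_left (le_max_right _ _))
  obtain ⟨ρ, hρ, hball⟩ := Metric.eventually_nhds_iff_ball.1
    (((e1.and e2).and (Filter.eventually_mem_set.2 hs)).and
      (Filter.eventually_mem_set.2 (interior_mem_nhds.2 hU)))
  -- ρ secures the bounds on Γ and its derivative, and 1/(2K) the condition 2Kr ≤ 1 for unit-time
  -- existence; since K ≥ 1, also r ≤ 1.
  set r := min ρ (1 / (2 * K)) with hr
  have hr0 : 0 < r := lt_min hρ (by positivity)
  have hsub : ball (0 : E) r ⊆ ball 0 ρ := ball_subset_ball (min_le_left _ _)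
  have hrK : 2 * (K * r) ≤ 1 := by
    calc 2 * (K * r) ≤ 2 * (K * (1 / (2 * K))) := by gcongr; exact min_le_right _ _
      _ = 1 := by field_simp
  have hr1 : r ≤ 1 := by nlinarith
  have hsubU : ball (0 : E) r ⊆ interior U := fun x hx => (hball x (hsub hx)).2
  have hdiff : ∀ x ∈ ball (0 : E) r, HasFDerivAt Γ (fderiv ℝ Γ x) x := fun x hx =>
    ((hΓ.contDiffAt (mem_interior_iff_mem_nhds.1 (hsubU hx))).differentiableAt
      (by simp)).hasFDerivAt
  refine ⟨r, hr0, hsubU.trans interior_subset, fun ζ₀ => ?_⟩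
  have hex : ∀ x : E, ∃ α : ℝ → F, x ∈ ball (0 : E) r → α 0 = ζ₀ ∧
      ∀ t ∈ Icc (0 : ℝ) 1, HasDerivWithinAt α (Γ (t • x) x (α t)) (Icc 0 1) t := by
    intro x
    by_cases hx : x ∈ ball (0 : E) r
    · obtain ⟨α, hα⟩ := exists_radial_solution (by positivity)
        (fun x hx => (hball x (hsub hx)).1.1.1)
        (fun y hy => (hdiff y hy).continuousAt.continuousWithinAt) hrK ζ₀ hx
      exact ⟨α, fun _ => hα⟩
    · exact ⟨0, fun h => absurd h hx⟩
  choose α hα using hex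
  have hsol : ∀ x ∈ ball (0 : E) r, HasFDerivAt (fun y => α y 1) ((Γ x).flip (α x 1)) x :=
    fun x hx => hasFDerivAt_radial_solution hr1 (by positivity)
      (fun x hx => (hball x (hsub hx)).1.1.1) (fun x hx => (hball x (hsub hx)).1.1.2) hdiff
      (fun x hx y hy => (hLip.norm_sub_le (hball x (hsub hx)).1.2 (hball y (hsub hy)).1.2).trans
        (by gcongr; exact le_max_right _ _))
      (fun x hx => hflat x (interior_subset (hsubU hx))) (fun x hx => (hα x hx).1)
      (fun x hx => (hα x hx).2) hx
  refine ⟨fun x => α x 1, ?_, hsol, ?_⟩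
  · have h0 : (0 : E) ∈ ball (0 : E) r := mem_ball_self hr0
    have hconst := constant_of_has_deriv_right_zero (f := α 0) (a := 0) (b := 1)
      (fun t ht => ((hα 0 h0).2 t ht).continuousWithinAt)
      (fun t ht => by
        have h := (hα 0 h0).2 t (Ico_subset_Icc_self ht)
        rw [map_zero, _root_.zero_apply] at h
        exact h.mono_of_mem_nhdsWithin
          (Filter.mem_of_superset (Icc_mem_nhdsGE ht.2) (Icc_subset_Icc_left ht.1)))
      1 (by simp)
    exact hconst.trans (hα 0 h0).1
  -- Bootstrap: the equation expresses the derivative through Γ and the solution, so each order of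
  -- smoothness gives the next.
  · have hn : ∀ k : ℕ, ContDiffOn ℝ k (fun x => α x 1) (ball 0 r) := by
      intro k
      induction k with
      | zero =>
        exact contDiffOn_zero.2 fun x hx => (hsol x hx).continuousAt.continuousWithinAt
      | succ k ih =>
        have hd : ContDiffOn ℝ k (fun x => (Γ x).flip (α x 1)) (ball 0 r) := by
          have h1 : ContDiffOn ℝ k (fun x => (Γ x).flip) (ball 0 r) :=
            (ContinuousLinearMap.flipₗᵢ ℝ E F F).contDiff.comp_contDiffOn
              ((hΓ.mono (hsubU.trans interior_subset)).of_le (by exact_mod_cast le_top))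
          exact h1.clm_apply ih
        push_cast
        rw [contDiffOn_succ_iff_fderiv_of_isOpen isOpen_ball]
        refine ⟨fun x hx => (hsol x hx).differentiableAt.differentiableWithinAt, by simp, ?_⟩
        exact hd.congr fun x hx => (hsol x hx).fderiv
    exact contDiffOn_infty.2 hn

end TotalDifferential


/-! ### Hadamard's lemma -/

section Hadamard

open Set Metric MeasureTheory

universe u

variable {E F : Type u} [NormedAddCommGroup E] [NormedSpace ℝ E] [ProperSpace E]
  [NormedAddCommGroup F] [NormedSpace ℝ F]

/-- The weight tᵏ is carried along so that the family is closed under differentiation: (k, H)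
becomes (k + 1, H'). -/
lemma hasFDerivAt_integral_ray {H : E → F} (hH : ContDiff ℝ ∞ H) (k : ℕ) (x : E) :
    HasFDerivAt (fun y => ∫ t in (0 : ℝ)..1, t ^ k • H (t • y))
      (∫ t in (0 : ℝ)..1, t ^ (k + 1) • fderiv ℝ H (t • x)) x := by
  have hcd : Continuous (fderiv ℝ H) := hH.continuous_fderiv (by simp)
  have hc' : Continuous fun q : ℝ × E => q.1 ^ (k + 1) • fderiv ℝ H (q.1 • q.2) := by fun_prop
  obtain ⟨C, hC⟩ := (isCompact_Icc (a := (0 : ℝ)) (b := 1)).prod (isCompact_closedBall x 1)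
    |>.exists_bound_of_continuousOn hc'.continuousOn
  have hcont : ∀ y, Continuous fun t : ℝ => t ^ k • H (t • y) := fun y => by
    have := hH.continuous
    fun_prop
  refine intervalIntegral.hasFDerivAt_integral_of_dominated_of_fderiv_le
    (F' := fun y t => t ^ (k + 1) • fderiv ℝ H (t • y)) (bound := fun _ => C)
    (closedBall_mem_nhds x one_pos)
    (Filter.Eventually.of_forall fun y => (hcont y).aestronglyMeasurable)
    ((hcont x).intervalIntegrable _ _)
    (Continuous.aestronglyMeasurable (by fun_prop)) ?_ (by simp) ?_
  · refine Filter.Eventually.of_forall fun t ht y hy => hC (t, y) ⟨?_, hy⟩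
    rw [uIoc_of_le zero_le_one] at ht
    exact ⟨ht.1.le, ht.2⟩
  · refine Filter.Eventually.of_forall fun t _ y _ => ?_
    have h1 : HasFDerivAt (fun y : E => t • y) (t • ContinuousLinearMap.id ℝ E) y :=
      (hasFDerivAt_id y).const_smul t
    have h2 : HasFDerivAt H (fderiv ℝ H (t • y)) (t • y) :=
      (hH.differentiable (by simp) _).hasFDerivAt
    refine ((h2.comp y h1).const_smul (t ^ k)).congr_fderiv ?_
    ext v
    simp [pow_succ, mul_smul]

/-- The induction must range over all target spaces, since the derivative takes values in `E →L[ℝ]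
F`; hence the common universe of E and F. -/
lemma contDiff_integral_ray [CompleteSpace F] {H : E → F} (hH : ContDiff ℝ ∞ H) (k : ℕ) :
    ContDiff ℝ ∞ fun y => ∫ t in (0 : ℝ)..1, t ^ k • H (t • y) := by
  have hn : ∀ m : ℕ, ∀ (F : Type u) [NormedAddCommGroup F] [NormedSpace ℝ F],
      ∀ H : E → F, ContDiff ℝ ∞ H → ∀ k : ℕ,
        ContDiff ℝ m fun y => ∫ t in (0 : ℝ)..1, t ^ k • H (t • y) := by
    intro m
    induction m with
    | zero =>
      intro F _ _ H hH k
      exact contDiff_zero.2 (continuous_iff_continuousAt.2 fun x =>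
        (hasFDerivAt_integral_ray hH k x).continuousAt)
    | succ m ih =>
      intro F _ _ H hH k
      push_cast
      refine contDiff_succ_iff_fderiv.2 ⟨fun x =>
        (hasFDerivAt_integral_ray hH k x).differentiableAt, by simp, ?_⟩
      have hfd : fderiv ℝ (fun y => ∫ t in (0 : ℝ)..1, t ^ k • H (t • y)) =
          fun x => ∫ t in (0 : ℝ)..1, t ^ (k + 1) • fderiv ℝ H (t • x) :=
        funext fun x => (hasFDerivAt_integral_ray hH k x).fderiv
      rw [hfd]
      exact ih (E →L[ℝ] F) (fderiv ℝ H) (hH.fderiv_right (by simp)) (k + 1)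
  exact contDiff_infty.2 fun m => hn m F H hH k

/-- **Hadamard's lemma**. -/
lemma exists_hadamard [CompleteSpace F] {G : E → F} (hG : ContDiff ℝ ∞ G) (b : E) :
    ∃ h : E → E →L[ℝ] F, ContDiff ℝ ∞ h ∧ h b = fderiv ℝ G b ∧
      ∀ y, G y = G b + h y (y - b) := by
  set G₁ : E → F := fun y => G (b + y) with hG₁
  have hG₁c : ContDiff ℝ ∞ G₁ := hG.comp (contDiff_const.add contDiff_id)
  have hd : ∀ y, HasFDerivAt G₁ (fderiv ℝ G (b + y)) y := fun y => by
    have h := (hG.differentiable (by simp) (b + y)).hasFDerivAt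
    have h' : HasFDerivAt (fun y => b + y) (ContinuousLinearMap.id ℝ E) y :=
      (hasFDerivAt_id y).const_add b
    exact h.comp y h'
  set h₁ : E → E →L[ℝ] F := fun y => ∫ t in (0 : ℝ)..1, t ^ 0 • fderiv ℝ G₁ (t • y) with hh₁
  have hh₁c : ContDiff ℝ ∞ h₁ := contDiff_integral_ray (hG₁c.fderiv_right (by simp)) 0
  refine ⟨fun y => h₁ (y - b), hh₁c.comp (contDiff_id.sub contDiff_const), ?_, fun y => ?_⟩
  · simp [hh₁, (hd 0).fderiv]
  · have hcf : Continuous (fderiv ℝ G₁) := hG₁c.continuous_fderiv (by simp)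
    have hcc : Continuous fun t : ℝ => fderiv ℝ G₁ (t • (y - b)) := by fun_prop
    have h1 : h₁ (y - b) (y - b) = ∫ t in (0 : ℝ)..1, fderiv ℝ G₁ (t • (y - b)) (y - b) := by
      simp only [hh₁, pow_zero, one_smul]
      exact ContinuousLinearMap.intervalIntegral_apply (hcc.intervalIntegrable _ _) _
    have h2 := intervalIntegral.integral_eq_sub_of_hasDerivAt (a := 0) (b := 1)
      (f := fun t : ℝ => G₁ (t • (y - b))) (f' := fun t => fderiv ℝ G₁ (t • (y - b)) (y - b))
      (fun t _ => by
        have hl : HasDerivAt (fun t : ℝ => t • (y - b)) (y - b) t := by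
          simpa using (hasDerivAt_id t).smul_const (y - b)
        have hf := (hd (t • (y - b))).differentiableAt.hasFDerivAt.comp_hasDerivAt t hl
        exact hf)
      ((hcc.clm_apply continuous_const).intervalIntegrable _ _)
    rw [h1, h2]
    simp [hG₁]

end Hadamard

/-! ### Derivations and 1-forms in charts -/

section Manifold

open Set

variable {n : ℕ} {M : Type*} [TopologicalSpace M] [ChartedSpace (EuclideanSpace ℝ (Fin n)) M]

lemma smooth_add_apply (f g : Smooth n M) (q : M) : (f + g) q = f q + g q := rfl
lemma smooth_sub_apply (f g : Smooth n M) (q : M) : (f - g) q = f q - g q := rfl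
lemma smooth_neg_apply (f : Smooth n M) (q : M) : (-f) q = -f q := rfl
lemma smooth_mul_apply (f g : Smooth n M) (q : M) : (f * g) q = f q * g q := rfl
lemma smooth_zero_apply (q : M) : (0 : Smooth n M) q = 0 := rfl
lemma smooth_algebraMap_apply (r : ℝ) (q : M) : algebraMap ℝ (Smooth n M) r q = r := rfl
lemma smooth_sum_apply {ι : Type*} (s : Finset ι) (f : ι → Smooth n M) (q : M) :
    (∑ i ∈ s, f i) q = ∑ i ∈ s, f i q :=
  map_sum (ContMDiffMap.evalRingHom q : Smooth n M →+* ℝ) f s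

lemma vec_sum_apply {A : Type*} [CommRing A] [Algebra ℝ A] {ι : Type*} (s : Finset ι)
    (Z : ι → Vec A) (g : A) : (∑ i ∈ s, Z i) g = ∑ i ∈ s, Z i g := by
  classical
  induction s using Finset.induction_on <;> simp_all

variable [T2Space M] [IsManifold (𝓡 n) ∞ M]

set_option linter.unusedSectionVars false

/-- A function that is smooth near `p` agrees near `p` with a smooth function. -/
lemma exists_smooth_eventuallyEq {p : M} {U : Set M} (hU : U ∈ 𝓝 p) {h : M → ℝ}
    (hh : ContMDiffOn (𝓡 n) 𝓘(ℝ) ∞ h U) : ∃ g : Smooth n M, g =ᶠ[𝓝 p] h := by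
  obtain ⟨χ, -, hχ⟩ := (SmoothBumpFunction.nhds_basis_tsupport (I := 𝓡 n) p).mem_iff.1
    (interior_mem_nhds.2 hU)
  refine ⟨⟨fun q => χ q * h q, contMDiff_of_tsupport fun q hq => ?_⟩, ?_⟩
  · have hq' : q ∈ interior U := hχ (closure_mono (fun y hy => by
      simp only [Function.mem_support] at hy ⊢
      exact left_ne_zero_of_mul hy) hq)
    exact χ.contMDiffAt.mul (hh.contMDiffAt (mem_interior_iff_mem_nhds.1 hq'))
  · filter_upwards [χ.eventuallyEq_one] with q hq
    change χ q * h q = h q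
    rw [hq]; simp

lemma exists_cutoff {p : M} {U : Set M} (hU : U ∈ 𝓝 p) :
    ∃ χ : Smooth n M, χ =ᶠ[𝓝 p] 1 ∧ tsupport χ ⊆ U := by
  obtain ⟨χ, -, hχ⟩ := (SmoothBumpFunction.nhds_basis_tsupport (I := 𝓡 n) p).mem_iff.1 hU
  exact ⟨⟨χ, χ.contMDiff⟩, χ.eventuallyEq_one, hχ⟩

/-- Derivations are local. -/
lemma derivation_congr (X : Vec (Smooth n M)) {f g : Smooth n M} {p : M} (h : f =ᶠ[𝓝 p] g) :
    X f p = X g p := by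
  obtain ⟨χ, h1, h2⟩ := exists_cutoff (n := n) h
  -- Apply X to this and evaluate at p, where χ = 1 and f = g.
  have h0 : χ * (f - g) = 0 := by
    ext q
    by_cases hq : q ∈ tsupport χ
    · have : f q = g q := h2 hq
      simp [smooth_mul_apply, smooth_sub_apply, this, smooth_zero_apply]
    · simp [smooth_mul_apply, image_eq_zero_of_notMem_tsupport hq, smooth_zero_apply]
  have h3 := congrArg (fun k : Smooth n M => k p) (congrArg X h0)
  simp only [Derivation.leibniz, map_zero, smul_eq_mul, smooth_add_apply, smooth_mul_apply,
    smooth_sub_apply, smooth_zero_apply, h1.self_of_nhds, h.self_of_nhds, map_sub] at h3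
  simpa [sub_eq_zero] using h3

lemma derivation_eventuallyEq (X : Vec (Smooth n M)) {f g : Smooth n M} {p : M}
    (h : f =ᶠ[𝓝 p] g) : X f =ᶠ[𝓝 p] X g :=
  h.eventuallyEq_nhds.mono fun _ hq => derivation_congr X hq

section Chart

variable {e : OpenPartialHomeomorph M (EuclideanSpace ℝ (Fin n))}

/-- The `i`-th partial derivative of a function on a manifold, in the chart `e`. -/
def chartDeriv (e : OpenPartialHomeomorph M (EuclideanSpace ℝ (Fin n))) (i : Fin n) (g : M → ℝ)
    (q : M) : ℝ :=
  fderiv ℝ (g ∘ e.symm) (e q) (EuclideanSpace.single i 1)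

lemma contDiffOn_comp_symm (he : e ∈ IsManifold.maximalAtlas (𝓡 n) ∞ M) (g : Smooth n M) :
    ContDiffOn ℝ ∞ (g ∘ e.symm) e.target :=
  contMDiffOn_iff_contDiffOn.1 (g.contMDiff.comp_contMDiffOn
    (contMDiffOn_symm_of_mem_maximalAtlas he))

lemma differentiableAt_comp_symm (he : e ∈ IsManifold.maximalAtlas (𝓡 n) ∞ M) (g : Smooth n M)
    {q : M} (hq : q ∈ e.source) : DifferentiableAt ℝ (g ∘ e.symm) (e q) :=
  ((contDiffOn_comp_symm he g).contDiffAt (e.open_target.mem_nhds (e.map_source hq))).differentiableAt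
    (by simp)

lemma contMDiffOn_chartDeriv (he : e ∈ IsManifold.maximalAtlas (𝓡 n) ∞ M) (i : Fin n)
    (g : Smooth n M) : ContMDiffOn (𝓡 n) 𝓘(ℝ) ∞ (chartDeriv e i g) e.source := by
  have h1 : ContDiffOn ℝ ∞ (fun y => fderiv ℝ (g ∘ e.symm) y (EuclideanSpace.single i 1))
      e.target :=
    ((contDiffOn_comp_symm he g).fderiv_of_isOpen e.open_target (by simp)).clm_apply
      contDiffOn_const
  exact (contMDiffOn_iff_contDiffOn.2 h1).comp (contMDiffOn_of_mem_maximalAtlas he)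
    (fun q hq => e.map_source hq)

/-- The coordinate vector field `∂/∂xⁱ` multiplied by a cutoff function. -/
def coordField (he : e ∈ IsManifold.maximalAtlas (𝓡 n) ∞ M) (χ : Smooth n M)
    (hχ : tsupport χ ⊆ e.source) (i : Fin n) : Vec (Smooth n M) :=
  Derivation.mk'
    { toFun := fun g => ⟨fun q => χ q * chartDeriv e i g q, contMDiff_of_tsupport fun q hq => by
        have hq' : q ∈ e.source := hχ (closure_mono (fun y hy => by
          simp only [Function.mem_support] at hy ⊢
          exact left_ne_zero_of_mul hy) hq)
        exact χ.contMDiff.contMDiffAt.mul ((contMDiffOn_chartDeriv he i g).contMDiffAt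
          (e.open_source.mem_nhds hq'))⟩
      map_add' := fun f g => by
        ext q
        change χ q * chartDeriv e i (f + g : Smooth n M) q =
          χ q * chartDeriv e i f q + χ q * chartDeriv e i g q
        -- Off the chart domain `chartDeriv` has no meaning, but χ vanishes there.
        by_cases hq : q ∈ e.source
        · have h : ((f + g : Smooth n M) : M → ℝ) ∘ e.symm = f ∘ e.symm + g ∘ e.symm := rfl
          rw [chartDeriv, h, fderiv_add (differentiableAt_comp_symm he f hq)
            (differentiableAt_comp_symm he g hq)]
          simp [chartDeriv, mul_add]
        · simp [image_eq_zero_of_notMem_tsupport (fun h => hq (hχ h))]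
      map_smul' := fun r g => by
        ext q
        change χ q * chartDeriv e i (r • g : Smooth n M) q = r * (χ q * chartDeriv e i g q)
        by_cases hq : q ∈ e.source
        · have h : ((r • g : Smooth n M) : M → ℝ) ∘ e.symm = r • (g ∘ e.symm) := rfl
          rw [chartDeriv, h, fderiv_const_smul (differentiableAt_comp_symm he g hq)]
          simp [chartDeriv]; ring
        · simp [image_eq_zero_of_notMem_tsupport (fun h => hq (hχ h))] }
    (fun f g => by
      ext q
      change χ q * chartDeriv e i (f * g : Smooth n M) q =
        f q * (χ q * chartDeriv e i g q) + g q * (χ q * chartDeriv e i f q)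
      by_cases hq : q ∈ e.source
      · have h : ((f * g : Smooth n M) : M → ℝ) ∘ e.symm = (f ∘ e.symm) * (g ∘ e.symm) := rfl
        rw [chartDeriv, h, fderiv_mul (differentiableAt_comp_symm he f hq)
          (differentiableAt_comp_symm he g hq)]
        simp [chartDeriv, e.left_inv hq]; ring
      · simp [image_eq_zero_of_notMem_tsupport (fun h => hq (hχ h))])

lemma coordField_apply (he : e ∈ IsManifold.maximalAtlas (𝓡 n) ∞ M) (χ : Smooth n M)
    (hχ : tsupport χ ⊆ e.source) (i : Fin n) (g : Smooth n M) (q : M) :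
    coordField he χ hχ i g q = χ q * chartDeriv e i g q := rfl

lemma euclidean_eq_sum_single (v : EuclideanSpace ℝ (Fin n)) :
    v = ∑ i, v i • EuclideanSpace.single i (1 : ℝ) := by
  ext j
  simp [Pi.single_apply]

/-- A derivation acts through the partial derivatives. -/
lemma derivation_eq_sum_chartDeriv (he : e ∈ IsManifold.maximalAtlas (𝓡 n) ∞ M) {q : M}
    (hq : q ∈ e.source) {f : Fin n → Smooth n M} (hf : ∀ i, IsCoordNear e i q (f i))
    (Y : Vec (Smooth n M)) (g : Smooth n M) :
    Y g q = ∑ i, Y (f i) q * chartDeriv e i g q := by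
  obtain ⟨G, hG⟩ := exists_smooth_eventuallyEq (n := n) (p := e q)
    (e.open_target.mem_nhds (e.map_source hq))
    (contMDiffOn_iff_contDiffOn.2 (contDiffOn_comp_symm he g))
  have hGc : ContDiff ℝ ∞ G := contMDiff_iff_contDiff.1 G.contMDiff
  obtain ⟨h, hhc, hhb, hh⟩ := exists_hadamard hGc (e q)
  have hk : ∀ i, ∃ k : Smooth n M, k =ᶠ[𝓝 q] fun y => h (e y) (EuclideanSpace.single i 1) := by
    intro i
    refine exists_smooth_eventuallyEq (e.open_source.mem_nhds hq) ?_
    exact (contMDiff_iff_contDiff.2 (hhc.clm_apply contDiff_const)).comp_contMDiffOn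
      (contMDiffOn_of_mem_maximalAtlas he)
  choose k hk using hk
  -- Hadamard's expansion g = g(q) + ∑ (xⁱ − xⁱ(q)) kᵢ near q. Under Y, evaluated at q, only
  -- Y(xⁱ)(q) kᵢ(q) survives, and kᵢ(q) is the i-th partial derivative of g.
  have hloc : g =ᶠ[𝓝 q] (algebraMap ℝ (Smooth n M) (g q) +
      ∑ i, (f i - algebraMap ℝ (Smooth n M) (e q i)) * k i : Smooth n M) := by
    have h1 : ∀ᶠ y in 𝓝 q, G (e y) = g (e.symm (e y)) :=
      (e.continuousAt hq).eventually hG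
    filter_upwards [h1, e.open_source.mem_nhds hq, Filter.eventually_all.2 hf,
      Filter.eventually_all.2 hk] with y hy1 hy2 hy3 hy4
    rw [e.left_inv hy2] at hy1
    rw [← hy1, hh, smooth_add_apply, smooth_sum_apply]
    have hb : G (e q) = g q := by
      have := hG.self_of_nhds
      simpa [e.left_inv hq] using this
    rw [hb, smooth_algebraMap_apply]
    congr 1
    conv_lhs => rw [euclidean_eq_sum_single (e y - e q)]
    rw [map_sum]
    refine Finset.sum_congr rfl fun i _ => ?_
    rw [map_smul, smooth_mul_apply, smooth_sub_apply, smooth_algebraMap_apply, hy3 i, hy4 i]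
    rfl
  rw [derivation_congr Y hloc, map_add, Derivation.map_algebraMap, zero_add, map_sum,
    smooth_sum_apply]
  refine Finset.sum_congr rfl fun i _ => ?_
  have hfi : f i q = e q i := (hf i).self_of_nhds
  have hki : k i q = chartDeriv e i g q := by
    rw [(hk i).self_of_nhds, chartDeriv, ← hG.fderiv_eq, ← hhb]
  simp only [Derivation.leibniz, map_sub, Derivation.map_algebraMap, sub_zero, smul_eq_mul,
    smooth_add_apply, smooth_mul_apply, smooth_sub_apply, smooth_algebraMap_apply, hfi, hki]
  ring

/-- Globally defined smooth functions `f i` and vector fields `X i` that are, on the neighbourhood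
`W` of `p`, the coordinates of the chart `e` and the coordinate vector fields. -/
structure IsCoordFrame (e : OpenPartialHomeomorph M (EuclideanSpace ℝ (Fin n))) (p : M)
    (W : Set M) (f : Fin n → Smooth n M) (X : Fin n → Vec (Smooth n M)) : Prop where
  isOpen : IsOpen W
  mem : p ∈ W
  subset : W ⊆ e.source
  coord : ∀ q ∈ W, ∀ i, f i q = e q i
  field : ∀ q ∈ W, ∀ i (g : Smooth n M), X i g q = chartDeriv e i g q

lemma exists_coordFrame (he : e ∈ IsManifold.maximalAtlas (𝓡 n) ∞ M) {p : M} (hp : p ∈ e.source) :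
    ∃ W f X, IsCoordFrame e p W f X := by
  obtain ⟨χ, h1, h2⟩ := exists_cutoff (n := n) (e.open_source.mem_nhds hp)
  have hf : ∀ i, ∃ f : Smooth n M, f =ᶠ[𝓝 p] fun q => e q i := by
    intro i
    refine exists_smooth_eventuallyEq (e.open_source.mem_nhds hp) ?_
    exact (contMDiff_iff_contDiff.2 (contDiff_piLp_apply (𝕜 := ℝ) (p := 2) (i := i))).comp_contMDiffOn
      (contMDiffOn_of_mem_maximalAtlas he)
  choose f hf using hf
  obtain ⟨W, hW, hWo, hpW⟩ := eventually_nhds_iff.1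
    ((h1.and (Filter.eventually_all.2 hf)).and (e.open_source.eventually_mem hp))
  refine ⟨W, f, coordField he χ h2, hWo, hpW, fun q hq => (hW q hq).2,
    fun q hq i => (hW q hq).1.2 i, fun q hq i g => ?_⟩
  rw [coordField_apply, (hW q hq).1.1, Pi.one_apply, one_mul]

namespace IsCoordFrame

variable {p : M} {W : Set M} {f : Fin n → Smooth n M} {X : Fin n → Vec (Smooth n M)}

lemma isCoordNear (h : IsCoordFrame e p W f X) {q : M} (hq : q ∈ W) (i : Fin n) :
    IsCoordNear e i q (f i) :=
  Filter.mem_of_superset (h.isOpen.mem_nhds hq) fun y hy => h.coord y hy i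

lemma derivation_apply (h : IsCoordFrame e p W f X) (he : e ∈ IsManifold.maximalAtlas (𝓡 n) ∞ M)
    {q : M} (hq : q ∈ W) (Y : Vec (Smooth n M)) (g : Smooth n M) :
    Y g q = ∑ i, Y (f i) q * X i g q := by
  rw [derivation_eq_sum_chartDeriv he (h.subset hq) (h.isCoordNear hq)]
  exact Finset.sum_congr rfl fun i _ => by rw [h.field q hq]

lemma field_coord (h : IsCoordFrame e p W f X) {q : M} (hq : q ∈ W) (i j : Fin n) :
    X i (f j) q = if i = j then 1 else 0 := by
  rw [h.field q hq, chartDeriv]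
  have hev : f j ∘ e.symm =ᶠ[𝓝 (e q)] fun y => y j := by
    have h1 : ∀ᶠ y in 𝓝 (e q), e.symm y ∈ W := by
      have hc := e.continuousAt_symm (e.map_source (h.subset hq))
      refine hc.eventually_mem ?_
      rw [e.left_inv (h.subset hq)]
      exact h.isOpen.mem_nhds hq
    filter_upwards [h1, e.open_target.mem_nhds (e.map_source (h.subset hq))] with y hy hy'
    rw [Function.comp_apply, h.coord _ hy, e.right_inv hy']
  rw [hev.fderiv_eq]
  have : HasFDerivAt (fun y : EuclideanSpace ℝ (Fin n) => y j)
    (EuclideanSpace.proj j : EuclideanSpace ℝ (Fin n) →L[ℝ] ℝ) (e q) :=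
    (EuclideanSpace.proj j : EuclideanSpace ℝ (Fin n) →L[ℝ] ℝ).hasFDerivAt
  rw [this.fderiv]
  simp [eq_comm]

/-- A 1-form is determined near `p` by its values on the coordinate fields. -/
lemma form_apply (h : IsCoordFrame e p W f X) (he : e ∈ IsManifold.maximalAtlas (𝓡 n) ∞ M)
    {q : M} (hq : q ∈ W) (α : Form1 (Smooth n M)) (Y : Vec (Smooth n M)) :
    α Y q = ∑ i, Y (f i) q * α (X i) q := by
  obtain ⟨χ, h1, h2⟩ := exists_cutoff (n := n) (h.isOpen.mem_nhds hq)
  -- The expansion of Y holds on W only; multiplied by χ it is an identity of global fields, to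
  -- which the function-linear α applies.
  have h3 : χ • Y = χ • ∑ i, Y (f i) • X i := by
    ext g y
    by_cases hy : y ∈ tsupport χ
    · simp only [Derivation.smul_apply, smul_eq_mul, smooth_mul_apply]
      rw [h.derivation_apply he (h2 hy) Y g, vec_sum_apply, smooth_sum_apply]
      rfl
    · simp only [Derivation.smul_apply, smul_eq_mul, smooth_mul_apply,
        image_eq_zero_of_notMem_tsupport hy, zero_mul]
  have h4 := congrArg (fun k : Smooth n M => k q) (congrArg α h3)
  simpa only [map_smul, map_sum, smul_eq_mul, smooth_mul_apply, h1.self_of_nhds, Pi.one_apply,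
    one_mul, smooth_sum_apply] using h4

end IsCoordFrame

end Chart

/-- Near p a 1-form is ∑ α(∂ᵢ) dxⁱ; after a cutoff this is a global combination of differentials,
which T kills. -/
lemma exactFormsSeparate_smooth : ExactFormsSeparate (Smooth n M) := by
  intro T hT
  ext α p
  have he := IsManifold.chart_mem_maximalAtlas (I := 𝓡 n) (n := ∞) p
  obtain ⟨W, f, X, h⟩ := exists_coordFrame he (mem_chart_source _ p)
  obtain ⟨χ, h1, h2⟩ := exists_cutoff (n := n) (h.isOpen.mem_nhds h.mem)
  have h3 : χ • α = χ • ∑ i, α (X i) • d0 (f i) := by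
    ext Y y
    by_cases hy : y ∈ tsupport χ
    · simp only [LinearMap.smul_apply, smul_eq_mul, smooth_mul_apply, LinearMap.sum_apply,
        smooth_sum_apply, h.form_apply he (h2 hy) α Y, d0_apply]
      congr 1
      exact Finset.sum_congr rfl fun i _ => mul_comm _ _
    · simp only [LinearMap.smul_apply, smul_eq_mul, smooth_mul_apply,
        image_eq_zero_of_notMem_tsupport hy, zero_mul]
  have h4 := congrArg (fun k : Smooth n M => k p) (congrArg T h3)
  simpa only [map_smul, map_sum, smul_eq_mul, smooth_mul_apply, h1.self_of_nhds, Pi.one_apply,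
    one_mul, smooth_sum_apply, hT, mul_zero, Finset.sum_const_zero, LinearMap.zero_apply, smooth_zero_apply] using h4

end Manifold


/-! ### Function-linearity of covariant derivatives and trilinear maps -/

section Tensoriality

variable {A : Type*} [CommRing A] [Algebra ℝ A]

namespace AffineConnection

variable (nabla : AffineConnection A)

lemma onForm1_apply (X : Vec A) (α : Form1 A) (Y : Vec A) :
    nabla.onForm1 X α Y = X (α Y) - α (nabla.toFun X Y) := rfl

lemma onForm1_smul_left (f : A) (X : Vec A) (α : Form1 A) :
    nabla.onForm1 (f • X) α = f • nabla.onForm1 X α := by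
  ext1 Y
  simp only [onForm1_apply, LinearMap.smul_apply, nabla.smul_left, map_smul, Derivation.smul_apply,
    smul_eq_mul, mul_sub]

lemma onForm1_add_left (X X' : Vec A) (α : Form1 A) :
    nabla.onForm1 (X + X') α = nabla.onForm1 X α + nabla.onForm1 X' α := by
  ext1 Y
  simp only [onForm1_apply, LinearMap.add_apply, nabla.add_left, map_add, Derivation.add_apply]
  ring

lemma onBivec_smul_left (f : A) (X : Vec A) (P : Bivec A) :
    nabla.onBivec (f • X) P = f • nabla.onBivec X P := by
  refine alt_ext fun α β => ?_
  simp only [onBivec_apply, AlternatingMap.smul_apply, onForm1_smul_left, alt_smul_left,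
    alt_smul_right, Derivation.smul_apply, smul_eq_mul]
  ring

lemma onBivec_add_left (X X' : Vec A) (P : Bivec A) :
    nabla.onBivec (X + X') P = nabla.onBivec X P + nabla.onBivec X' P := by
  refine alt_ext fun α β => ?_
  simp only [onBivec_apply, AlternatingMap.add_apply, onForm1_add_left, alt_add_left,
    alt_add_right, Derivation.add_apply]
  ring

lemma onBivec_smul (X : Vec A) (f : A) (P : Bivec A) :
    nabla.onBivec X (f • P) = f • nabla.onBivec X P + X f • P := by
  refine alt_ext fun α β => ?_
  simp only [onBivec_apply, AlternatingMap.smul_apply, AlternatingMap.add_apply, smul_eq_mul,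
    Derivation.leibniz]
  ring

lemma deriv2_smul_left (P : Bivec A) (f : A) (X Y : Vec A) :
    nabla.deriv2 P (f • X) Y = f • nabla.deriv2 P X Y := by
  simp only [deriv2, onBivec_smul_left, nabla.smul_left, smul_sub]

lemma deriv2_smul_right (P : Bivec A) (f : A) (X Y : Vec A) :
    nabla.deriv2 P X (f • Y) = f • nabla.deriv2 P X Y := by
  simp only [deriv2, onBivec_smul_left, nabla.leibniz, onBivec_smul, onBivec_add_left, smul_sub]
  abel

end AffineConnection

section Trilinear

variable (T : Form1 A →ₗ[A] Form1 A →ₗ[A] Form1 A →ₗ[A] Form2 A) (f : A)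
  (α α' β β' γ γ' : Form1 A) (X Y : Vec A)

lemma trilinear_add_left : T (α + α') β γ ![X, Y] = T α β γ ![X, Y] + T α' β γ ![X, Y] := by
  simp only [map_add, LinearMap.add_apply, AlternatingMap.add_apply]

lemma trilinear_smul_left : T (f • α) β γ ![X, Y] = f * T α β γ ![X, Y] := by
  simp only [map_smul, LinearMap.smul_apply, AlternatingMap.smul_apply, smul_eq_mul]

lemma trilinear_add_mid : T α (β + β') γ ![X, Y] = T α β γ ![X, Y] + T α β' γ ![X, Y] := by
  simp only [map_add, LinearMap.add_apply, AlternatingMap.add_apply]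

lemma trilinear_smul_mid : T α (f • β) γ ![X, Y] = f * T α β γ ![X, Y] := by
  simp only [map_smul, LinearMap.smul_apply, AlternatingMap.smul_apply, smul_eq_mul]

lemma trilinear_add_right : T α β (γ + γ') ![X, Y] = T α β γ ![X, Y] + T α β γ' ![X, Y] := by
  simp only [map_add, AlternatingMap.add_apply]

lemma trilinear_smul_right : T α β (f • γ) ![X, Y] = f * T α β γ ![X, Y] := by
  simp only [map_smul, AlternatingMap.smul_apply, smul_eq_mul]

end Trilinear

end Tensoriality

section Polynomial

open MvPolynomial

lemma derivation_aeval {A : Type*} [CommRing A] [Algebra ℝ A] {n : ℕ} (Y : Vec A) (f : Fin n → A)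
    (P : MvPolynomial (Fin n) ℝ) :
    Y (aeval f P) = ∑ i, aeval f (pderiv i P) * Y (f i) := by
  induction P using MvPolynomial.induction_on with
  | C r => simp
  | add P Q hP hQ => simp only [map_add, hP, hQ, add_mul, Finset.sum_add_distrib]
  | mul_X P j hP =>
    simp only [map_mul, aeval_X, Derivation.leibniz, smul_eq_mul, hP, pderiv_X, map_add, add_mul,
      Finset.sum_add_distrib, Finset.mul_sum]
    congr 1
    · rw [Finset.sum_eq_single j]
      · simp
      · intro b _ hb; simp [hb.symm]
      · simp
    · exact Finset.sum_congr rfl fun i _ => by ring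

lemma pderiv_three_eq_zero {n : ℕ} {P : MvPolynomial (Fin n) ℝ} (hP : P.totalDegree ≤ 2)
    (a b c : Fin n) : pderiv a (pderiv b (pderiv c P)) = 0 := by
  ext m
  rw [coeff_pderiv, coeff_pderiv, coeff_pderiv, coeff_eq_zero_of_totalDegree_lt]
  · simp
  · have h : (m + Finsupp.single a 1 + Finsupp.single b 1 + Finsupp.single c 1).degree =
        m.degree + 1 + 1 + 1 := by
      simp [map_add]
    change _ < (m + Finsupp.single a 1 + Finsupp.single b 1 + Finsupp.single c 1).degree
    omega

end Polynomial

/-! ### Affine charts: covariant derivatives as partial derivatives, and quadratic components -/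

section Manifold

open Set

variable {n : ℕ} {M : Type*} [TopologicalSpace M] [ChartedSpace (EuclideanSpace ℝ (Fin n)) M]

lemma smooth_aeval_apply (f : Fin n → Smooth n M) (P : MvPolynomial (Fin n) ℝ) (q : M) :
    (MvPolynomial.aeval f P : Smooth n M) q = MvPolynomial.eval (fun k => f k q) P := by
  induction P using MvPolynomial.induction_on with
  | C r => simp [smooth_algebraMap_apply]
  | add P Q hP hQ => simp [smooth_add_apply, hP, hQ]
  | mul_X P j hP => simp [smooth_mul_apply, hP]

lemma smul_vec_congr {W : Set M} {Y Z : Vec (Smooth n M)} (h : ∀ q ∈ W, ∀ g, Y g q = Z g q)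
    (χ : Smooth n M) (hχ : tsupport χ ⊆ W) : χ • Y = χ • Z := by
  ext g y
  simp only [Derivation.smul_apply, smul_eq_mul, smooth_mul_apply]
  by_cases hy : y ∈ tsupport χ
  · rw [h y (hχ hy)]
  · simp only [image_eq_zero_of_notMem_tsupport hy, zero_mul]

lemma smul_form_congr {W : Set M} {α β : Form1 (Smooth n M)} (h : ∀ q ∈ W, ∀ Z, α Z q = β Z q)
    (χ : Smooth n M) (hχ : tsupport χ ⊆ W) : χ • α = χ • β := by
  ext Z y
  simp only [LinearMap.smul_apply, smul_eq_mul, smooth_mul_apply]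
  by_cases hy : y ∈ tsupport χ
  · rw [h y (hχ hy)]
  · simp only [image_eq_zero_of_notMem_tsupport hy, zero_mul]

variable [T2Space M] [IsManifold (𝓡 n) ∞ M]

set_option linter.unusedSectionVars false

/-- A function-linear map vanishes where its argument vanishes. -/
lemma tensor_local {V : Type*} [AddCommGroup V] [Module (Smooth n M) V] {T : V → Smooth n M}
    (hT : ∀ (χ : Smooth n M) x, T (χ • x) = χ * T x) {q : M} {W : Set M} (hW : W ∈ 𝓝 q)
    {x y : V} (hxy : ∀ χ : Smooth n M, tsupport χ ⊆ W → χ • x = χ • y) : T x q = T y q := by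
  obtain ⟨χ, h1, h2⟩ := exists_cutoff (n := n) hW
  have h3 := congrArg (fun k : Smooth n M => k q) (congrArg T (hxy χ h2))
  simpa only [hT, smooth_mul_apply, h1.self_of_nhds, Pi.one_apply, one_mul] using h3

lemma bivec_congr (P : Bivec (Smooth n M)) {q : M} {W : Set M} (hW : W ∈ 𝓝 q)
    {α α' β β' : Form1 (Smooth n M)} (h : ∀ q ∈ W, ∀ Z, α Z q = α' Z q)
    (h' : ∀ q ∈ W, ∀ Z, β Z q = β' Z q) : P ![α, β] q = P ![α', β'] q := by
  rw [tensor_local (T := fun α => P ![α, β]) (fun χ x => alt_smul_left P χ x β) hW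
      (smul_form_congr h),
    tensor_local (T := fun β => P ![α', β]) (fun χ x => alt_smul_right P χ α' x) hW
      (smul_form_congr h')]

namespace IsCoordFrame

variable {e : OpenPartialHomeomorph M (EuclideanSpace ℝ (Fin n))}
  {p : M} {W : Set M} {f : Fin n → Smooth n M} {X : Fin n → Vec (Smooth n M)}

lemma vec_induction (h : IsCoordFrame e p W f X) (he : e ∈ IsManifold.maximalAtlas (𝓡 n) ∞ M)
    {q : M} (hq : q ∈ W) {S : Vec (Smooth n M) → Smooth n M} (hadd : ∀ Y Z, S (Y + Z) = S Y + S Z)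
    (hsmul : ∀ (g : Smooth n M) Y, S (g • Y) = g * S Y) (hS : ∀ i, S (X i) q = 0)
    (Y : Vec (Smooth n M)) : S Y q = 0 := by
  have := h.form_apply he hq ⟨⟨S, hadd⟩, hsmul⟩ Y
  exact this.trans (Finset.sum_eq_zero fun i _ => by
    change _ * S (X i) q = 0
    rw [hS i, mul_zero])

/-- Pointwise counterpart of `ExactFormsSeparate`: vanishing on the coordinate differentials at the
single point q is enough. -/
lemma form_induction (h : IsCoordFrame e p W f X) (he : e ∈ IsManifold.maximalAtlas (𝓡 n) ∞ M)
    {q : M} (hq : q ∈ W) {S : Form1 (Smooth n M) → Smooth n M}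
    (hadd : ∀ α β, S (α + β) = S α + S β)
    (hsmul : ∀ (g : Smooth n M) α, S (g • α) = g * S α) (hS : ∀ i, S (d0 (f i)) q = 0)
    (α : Form1 (Smooth n M)) : S α q = 0 := by
  have h1 : S α q = S (∑ i, α (X i) • d0 (f i)) q := by
    refine tensor_local hsmul (h.isOpen.mem_nhds hq) (smul_form_congr fun y hy Z => ?_)
    rw [h.form_apply he hy, LinearMap.sum_apply, smooth_sum_apply]
    exact Finset.sum_congr rfl fun i _ => mul_comm _ _
  let S' : Form1 (Smooth n M) →ₗ[Smooth n M] Smooth n M := ⟨⟨S, hadd⟩, hsmul⟩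
  have h2 : S (∑ i, α (X i) • d0 (f i)) = ∑ i, α (X i) * S (d0 (f i)) := by
    change S' _ = ∑ i, α (X i) * S' _
    simp only [map_sum, map_smul, smul_eq_mul]
  rw [h1, h2, smooth_sum_apply]
  exact Finset.sum_eq_zero fun i _ => by rw [smooth_mul_apply, hS, mul_zero]

lemma eventually_mem (h : IsCoordFrame e p W f X) : ∀ᶠ q in 𝓝 p, q ∈ W :=
  h.isOpen.eventually_mem h.mem

lemma field_field_coord (h : IsCoordFrame e p W f X) {q : M} (hq : q ∈ W) (Y : Vec (Smooth n M))
    (b i : Fin n) : Y (X b (f i)) q = 0 := by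
  have h1 : X b (f i) =ᶠ[𝓝 q] algebraMap ℝ (Smooth n M) (if b = i then 1 else 0) :=
    Filter.mem_of_superset (h.isOpen.mem_nhds hq) fun y hy => h.field_coord hy b i
  rw [derivation_congr Y h1, Derivation.map_algebraMap, smooth_zero_apply]

/-- A function with vanishing partial derivatives near `p` is constant near `p`. -/
lemma eventually_const (h : IsCoordFrame e p W f X) (he : e ∈ IsManifold.maximalAtlas (𝓡 n) ∞ M)
    {g : Smooth n M} (hg : ∀ᶠ q in 𝓝 p, ∀ i, X i g q = 0) : ∀ᶠ q in 𝓝 p, g q = g p := by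
  have hp := h.subset h.mem
  have h1 : ∀ᶠ y in 𝓝 (e p), (e.symm y ∈ W ∧ ∀ i, X i g (e.symm y) = 0) ∧ y ∈ e.target := by
    refine Filter.Eventually.and ?_ (e.open_target.eventually_mem (e.map_source hp))
    have hc := e.continuousAt_symm (e.map_source hp)
    rw [ContinuousAt, e.left_inv hp] at hc
    exact hc.eventually (h.eventually_mem.and hg)
  obtain ⟨r, hr, hball⟩ := Metric.eventually_nhds_iff_ball.1 h1
  have hconst : ∀ y ∈ Metric.ball (e p) r, (g ∘ e.symm) y = (g ∘ e.symm) (e p) := by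
    intro y hy
    refine Metric.isOpen_ball.is_const_of_fderiv_eq_zero (𝕜 := ℝ) (convex_ball _ _).isPreconnected
      (fun z hz => ?_) (fun z hz => ?_) hy (Metric.mem_ball_self hr)
    · exact ((contDiffOn_comp_symm he g).contDiffAt
        (e.open_target.mem_nhds (hball z hz).2)).differentiableAt (by simp)
        |>.differentiableWithinAt
    · obtain ⟨⟨hz1, hz2⟩, hz3⟩ := hball z hz
      ext v
      rw [euclidean_eq_sum_single v, map_sum]
      refine Finset.sum_eq_zero fun i _ => ?_
      have := hz2 i
      rw [h.field _ hz1, chartDeriv, e.right_inv hz3] at this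
      rw [map_smul, this, smul_zero]
  have h2 : ∀ᶠ q in 𝓝 p, e q ∈ Metric.ball (e p) r :=
    (e.continuousAt hp).eventually_mem (Metric.ball_mem_nhds _ hr)
  filter_upwards [h2, e.open_source.eventually_mem hp] with q hq hq'
  have := hconst _ hq
  simpa [e.left_inv hq', e.left_inv hp] using this

lemma field_aeval (h : IsCoordFrame e p W f X) {q : M} (hq : q ∈ W) (a : Fin n)
    (P : MvPolynomial (Fin n) ℝ) :
    X a (MvPolynomial.aeval f P) q =
      (MvPolynomial.aeval f (MvPolynomial.pderiv a P) : Smooth n M) q := by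
  rw [derivation_aeval, smooth_sum_apply, Finset.sum_eq_single a]
  · rw [smooth_mul_apply, h.field_coord hq, if_pos rfl, mul_one]
  · intro b _ hb
    rw [smooth_mul_apply, h.field_coord hq, if_neg hb.symm, mul_zero]
  · simp

/-- A function with vanishing third partial derivatives near `p` is a quadratic polynomial
near `p`. -/
lemma exists_quadratic (h : IsCoordFrame e p W f X) (he : e ∈ IsManifold.maximalAtlas (𝓡 n) ∞ M)
    {G : Smooth n M} (hG : ∀ᶠ q in 𝓝 p, ∀ a b c, X a (X b (X c G)) q = 0) :
    ∃ P : MvPolynomial (Fin n) ℝ, P.totalDegree ≤ 2 ∧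
      ∀ᶠ q in 𝓝 p, G q = MvPolynomial.eval (fun k => f k q) P := by
  classical
  set κ : Fin n → Fin n → ℝ := fun b c => X b (X c G) p with hκ
  -- The commutator of two coordinate fields kills the coordinates on W, hence every function there.
  have hκsymm : ∀ b c, κ b c = κ c b := by
    intro b c
    have h1 := h.derivation_apply he h.mem ⁅X b, X c⁆ G
    simp only [Derivation.commutator_apply, smooth_sub_apply, h.field_field_coord h.mem, sub_zero,
      zero_mul, Finset.sum_const_zero] at h1
    exact sub_eq_zero.1 h1
  have h2 : ∀ᶠ q in 𝓝 p, ∀ b c, X b (X c G) q = κ b c := by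
    refine Filter.eventually_all.2 fun b => Filter.eventually_all.2 fun c => ?_
    exact h.eventually_const he (hG.mono fun q hq a => hq a b c)
  set K : Fin n → Smooth n M := fun c =>
    X c G - ∑ b, algebraMap ℝ (Smooth n M) (κ b c) * f b with hK
  have h3 : ∀ᶠ q in 𝓝 p, ∀ c, K c q = K c p := by
    refine Filter.eventually_all.2 fun c => h.eventually_const he ?_
    filter_upwards [h2, h.eventually_mem] with q hq hqW a
    have hsum : ∑ b, κ b c * X a (f b) q = κ a c := by
      simp [h.field_coord hqW]
    simp only [hK, map_sub, map_sum, Derivation.leibniz, Derivation.map_algebraMap, mul_zero,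
      add_zero, smul_eq_mul, smooth_sub_apply, smooth_sum_apply, smooth_mul_apply,
      smooth_algebraMap_apply, hq, hsum, sub_self]
  -- The Taylor polynomial without its constant: half the Hessian κ, because κ is symmetric, and K
  -- for the gradient left once κ is removed. Then G − P₀ has zero gradient near p.
  set P₀ : MvPolynomial (Fin n) ℝ :=
    ∑ b, ∑ c, MvPolynomial.C (κ b c / 2) * (MvPolynomial.X b * MvPolynomial.X c) +
      ∑ c, MvPolynomial.C (K c p) * MvPolynomial.X c with hP₀
  have hd : ∀ x : Fin n → ℝ, ∀ a, MvPolynomial.eval x (MvPolynomial.pderiv a P₀) =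
      ∑ b, κ b a * x b + K a p := by
    intro x a
    have e1 : ∑ b, ∑ c, κ b c / 2 * (x b * (Pi.single a 1 : Fin n → ℝ) c) =
        ∑ b, κ b a / 2 * x b := by
      refine Finset.sum_congr rfl fun b _ => ?_
      simp [Pi.single_apply]
    have e2 : ∑ b, ∑ c, κ b c / 2 * (x c * (Pi.single a 1 : Fin n → ℝ) b) =
        ∑ b, κ b a / 2 * x b := by
      rw [Finset.sum_comm]
      refine Finset.sum_congr rfl fun c _ => ?_
      simp [Pi.single_apply, hκsymm c a]
    have e3 : ∑ c, K c p * (Pi.single a 1 : Fin n → ℝ) c = K a p := by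
      simp [Pi.single_apply]
    have hs : ∀ c, MvPolynomial.eval x (Pi.single (M := fun _ => MvPolynomial (Fin n) ℝ) a 1 c) =
        (Pi.single a 1 : Fin n → ℝ) c := by
      intro c
      by_cases hc : c = a <;> simp [hc]
    simp only [hP₀, map_add, map_sum, Derivation.leibniz, MvPolynomial.pderiv_C,
      MvPolynomial.pderiv_X, mul_zero, add_zero, smul_eq_mul, map_mul, MvPolynomial.eval_C,
      MvPolynomial.eval_X]
    simp only [hs, mul_add, Finset.sum_add_distrib, e1, e2, e3]
    rw [← Finset.sum_add_distrib]
    congr 1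
    exact Finset.sum_congr rfl fun b _ => by ring
  have h4 : ∀ᶠ q in 𝓝 p, (G - MvPolynomial.aeval f P₀ : Smooth n M) q =
      (G - MvPolynomial.aeval f P₀ : Smooth n M) p := by
    refine h.eventually_const he ?_
    filter_upwards [h3, h.eventually_mem] with q hq hqW a
    rw [map_sub, smooth_sub_apply, h.field_aeval hqW, smooth_aeval_apply, hd, ← hq a]
    simp only [hK, smooth_sub_apply, smooth_sum_apply, smooth_mul_apply, smooth_algebraMap_apply]
    ring
  refine ⟨P₀ + MvPolynomial.C ((G - MvPolynomial.aeval f P₀ : Smooth n M) p), ?_, ?_⟩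
  · have hX : ∀ b : Fin n, (MvPolynomial.X b : MvPolynomial (Fin n) ℝ).totalDegree ≤ 1 := fun b =>
      (MvPolynomial.totalDegree_X b).le
    have hC : ∀ (r : ℝ) (Q : MvPolynomial (Fin n) ℝ),
        (MvPolynomial.C r * Q).totalDegree ≤ Q.totalDegree := fun r Q => by
      refine (MvPolynomial.totalDegree_mul _ _).trans ?_
      simp
    refine (MvPolynomial.totalDegree_add _ _).trans (max_le ?_
      ((MvPolynomial.totalDegree_C _).le.trans (Nat.zero_le _)))
    refine (MvPolynomial.totalDegree_add _ _).trans (max_le ?_ ?_)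
    · refine MvPolynomial.totalDegree_finsetSum_le fun b _ =>
        MvPolynomial.totalDegree_finsetSum_le fun c _ => ?_
      exact (hC _ _).trans ((MvPolynomial.totalDegree_mul _ _).trans (add_le_add (hX b) (hX c)))
    · exact MvPolynomial.totalDegree_finsetSum_le fun c _ =>
        (hC _ _).trans ((hX c).trans one_le_two)
  · filter_upwards [h4] with q hq
    rw [map_add, MvPolynomial.eval_C, ← hq, smooth_sub_apply, smooth_aeval_apply]
    ring

/-- A quadratic polynomial has vanishing third partial derivatives. -/
lemma third_eq_zero_of_quadratic (h : IsCoordFrame e p W f X) {G : Smooth n M}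
    {P : MvPolynomial (Fin n) ℝ} (hP : P.totalDegree ≤ 2)
    (hG : ∀ᶠ q in 𝓝 p, G q = MvPolynomial.eval (fun k => e q k) P) (a b c : Fin n) :
    X a (X b (X c G)) p = 0 := by
  have hd : ∀ (Q : MvPolynomial (Fin n) ℝ) (i : Fin n) (H : Smooth n M),
      H =ᶠ[𝓝 p] (MvPolynomial.aeval f Q : Smooth n M) →
      X i H =ᶠ[𝓝 p] (MvPolynomial.aeval f (MvPolynomial.pderiv i Q) : Smooth n M) := by
    intro Q i H hH
    filter_upwards [derivation_eventuallyEq (X i) hH, h.eventually_mem] with q hq hqW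
    rw [hq, h.field_aeval hqW]
  have h0 : G =ᶠ[𝓝 p] (MvPolynomial.aeval f P : Smooth n M) := by
    filter_upwards [hG, h.eventually_mem] with q hq hqW
    rw [hq, smooth_aeval_apply]
    simp only [h.coord q hqW]
  have := (hd _ a _ (hd _ b _ (hd _ c _ h0))).self_of_nhds
  rw [this, pderiv_three_eq_zero hP, map_zero, smooth_zero_apply]

section Affine

variable {nabla : AffineConnection (Smooth n M)}

/-- ∇dxⁱ = 0 makes the Christoffel symbols vanish on W. Off W the field may be nonzero, so its
removal inside tensors needs `tensor_local`. -/
lemma nabla_field_eq_zero (h : IsCoordFrame e p W f X) (hn : IsAffineChart nabla e) {q : M}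
    (hq : q ∈ W) (a b : Fin n) (g : Smooth n M) : nabla.toFun (X a) (X b) g q = 0 := by
  rw [h.derivation_apply hn.1 hq]
  refine Finset.sum_eq_zero fun i _ => ?_
  have h1 := hn.2 q (h.subset hq) i (f i) (h.isCoordNear hq i) (X a) (X b)
  rw [AffineConnection.onForm1_apply, d0_apply, d0_apply, smooth_sub_apply,
    h.field_field_coord hq, zero_sub, neg_eq_zero] at h1
  rw [h1, zero_mul]

lemma onBivec_coord (h : IsCoordFrame e p W f X) (hn : IsAffineChart nabla e) {q : M}
    (hq : q ∈ W) (Y : Vec (Smooth n M)) (P : Bivec (Smooth n M)) (i j : Fin n) :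
    nabla.onBivec Y P ![d0 (f i), d0 (f j)] q = Y (P ![d0 (f i), d0 (f j)]) q := by
  have hz : ∀ i, ∀ y ∈ W, ∀ Z, nabla.onForm1 Y (d0 (f i)) Z y = (0 : Form1 (Smooth n M)) Z y :=
    fun i y hy Z => hn.2 y (h.subset hy) i (f i) (h.isCoordNear hy i) Y Z
  have h0 : ∀ β, P ![0, β] = 0 := fun β => by simpa using alt_smul_left P 0 0 β
  have h0' : ∀ β, P ![β, 0] = 0 := fun β => by simpa using alt_smul_right P 0 β 0
  rw [AffineConnection.onBivec_apply, smooth_sub_apply, smooth_sub_apply,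
    bivec_congr P (h.isOpen.mem_nhds hq) (hz i) (fun _ _ _ => rfl),
    bivec_congr P (h.isOpen.mem_nhds hq) (fun _ _ _ => rfl) (hz j), h0, h0', smooth_zero_apply,
    sub_zero, sub_zero]

lemma deriv2_coord (h : IsCoordFrame e p W f X) (hn : IsAffineChart nabla e) {q : M}
    (hq : q ∈ W) (P : Bivec (Smooth n M)) (b c i j : Fin n) :
    nabla.deriv2 P (X b) (X c) ![d0 (f i), d0 (f j)] q =
      X b (X c (P ![d0 (f i), d0 (f j)])) q := by
  have h1 : nabla.onBivec (nabla.toFun (X b) (X c)) P ![d0 (f i), d0 (f j)] q = 0 := by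
    rw [h.onBivec_coord hn hq]
    exact h.nabla_field_eq_zero hn hq b c _
  rw [AffineConnection.deriv2, AlternatingMap.sub_apply, smooth_sub_apply, h1, sub_zero,
    h.onBivec_coord hn hq]
  exact derivation_congr (X b) (Filter.mem_of_superset (h.isOpen.mem_nhds hq) fun y hy =>
    h.onBivec_coord hn hy (X c) P i j)

/-- In an affine chart, third covariant derivatives are third partial derivatives. -/
lemma deriv3_coord (h : IsCoordFrame e p W f X) (hn : IsAffineChart nabla e) {q : M}
    (hq : q ∈ W) (P : Bivec (Smooth n M)) (a b c i j : Fin n) :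
    nabla.deriv3 P (X a) (X b) (X c) ![d0 (f i), d0 (f j)] q =
      X a (X b (X c (P ![d0 (f i), d0 (f j)]))) q := by
  have hz : ∀ a b, ∀ χ : Smooth n M, tsupport χ ⊆ W →
      χ • nabla.toFun (X a) (X b) = χ • (0 : Vec (Smooth n M)) := fun a b =>
    smul_vec_congr fun y hy g => h.nabla_field_eq_zero hn hy a b g
  have hl : nabla.deriv2 P (nabla.toFun (X a) (X b)) (X c) ![d0 (f i), d0 (f j)] q = 0 := by
    have h0 : nabla.deriv2 P 0 (X c) = 0 := by
      simpa using nabla.deriv2_smul_left P 0 0 (X c)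
    rw [tensor_local (T := fun Y => nabla.deriv2 P Y (X c) ![d0 (f i), d0 (f j)])
      (fun χ Y => by rw [nabla.deriv2_smul_left]; rfl) (h.isOpen.mem_nhds hq) (hz a b), h0]
    rfl
  have hr : nabla.deriv2 P (X b) (nabla.toFun (X a) (X c)) ![d0 (f i), d0 (f j)] q = 0 := by
    have h0 : nabla.deriv2 P (X b) 0 = 0 := by
      simpa using nabla.deriv2_smul_right P 0 (X b) 0
    rw [tensor_local (T := fun Y => nabla.deriv2 P (X b) Y ![d0 (f i), d0 (f j)])
      (fun χ Y => by rw [nabla.deriv2_smul_right]; rfl) (h.isOpen.mem_nhds hq) (hz a c), h0]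
    rfl
  rw [AffineConnection.deriv3, AlternatingMap.sub_apply, AlternatingMap.sub_apply,
    smooth_sub_apply, smooth_sub_apply, hl, hr, sub_zero, sub_zero, h.onBivec_coord hn hq]
  exact derivation_congr (X a) (Filter.mem_of_superset (h.isOpen.mem_nhds hq) fun y hy =>
    h.deriv2_coord hn hy P b c i j)

end Affine

end IsCoordFrame

section Quadratic

variable {π : Bivec (Smooth n M)} {Om : Form2 (Smooth n M)} {nabla : AffineConnection (Smooth n M)}
  {Mc : Form1 (Smooth n M) →ₗ[Smooth n M] Form1 (Smooth n M) →ₗ[Smooth n M]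
    Form1 (Smooth n M) →ₗ[Smooth n M] Form2 (Smooth n M)}

lemma isQuadratic_of_metacurvature_eq_zero (hOm : IsInverse π Om)
    (hM : ∀ α β γ X Y, Mc α β γ ![X, Y] =
      -(nabla.deriv3 π (sharp π α) (sharp π β) (sharp π γ)) ![flat Om X, flat Om Y])
    (h0 : Mc = 0) : IsQuadratic nabla π := by
  intro e hn p hp i j u v hu hv
  obtain ⟨W, f, X, h⟩ := exists_coordFrame hn.1 hp
  have hz : ∀ a b c, nabla.deriv3 π (X a) (X b) (X c) ![d0 (f i), d0 (f j)] = 0 := by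
    intro a b c
    -- These arguments cancel every π and ω and leave the components of ∇³π.
    have := hM (flat Om (X a)) (flat Om (X b)) (flat Om (X c)) (sharp π (d0 (f i)))
      (sharp π (d0 (f j)))
    rw [hOm.2, hOm.2, hOm.2, hOm.1, hOm.1, h0] at this
    exact neg_eq_zero.1 this.symm
  obtain ⟨P, hP, hev⟩ := h.exists_quadratic hn.1 (G := π ![d0 (f i), d0 (f j)]) (by
    filter_upwards [h.eventually_mem] with q hq a b c
    rw [← h.deriv3_coord hn hq, hz, smooth_zero_apply])
  refine ⟨P, hP, ?_⟩
  -- The given extensions u, v of the coordinates may differ from `f i`, `f j` away from p; locality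
  -- of π makes this harmless.
  have hcu : ∀ {k : Fin n} {w : Smooth n M}, IsCoordNear e k p w → ∀ᶠ q in 𝓝 p,
      ∀ Z : Vec (Smooth n M), d0 w Z q = d0 (f k) Z q := by
    intro k w hw
    have : w =ᶠ[𝓝 p] f k := by
      filter_upwards [hw, h.eventually_mem] with q hq hqW
      rw [hq, h.coord q hqW]
    filter_upwards [this.eventuallyEq_nhds] with q hq Z
    exact derivation_congr Z hq
  obtain ⟨W', hW', hWo, hpW⟩ := eventually_nhds_iff.1 ((hcu hu).and (hcu hv))
  filter_upwards [hev, h.eventually_mem, hWo.mem_nhds hpW] with q hq hqW hqW'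
  rw [bivec_congr π (hWo.mem_nhds hqW') (fun y hy => (hW' y hy).1) (fun y hy => (hW' y hy).2), hq]
  simp only [h.coord q hqW]

set_option maxHeartbeats 1000000 in
lemma metacurvature_eq_zero_of_isQuadratic (hOm : IsInverse π Om)
    (hM : ∀ α β γ X Y, Mc α β γ ![X, Y] =
      -(nabla.deriv3 π (sharp π α) (sharp π β) (sharp π γ)) ![flat Om X, flat Om Y])
    (hcover : ∀ p : M, ∃ e, IsAffineChart nabla e ∧ p ∈ e.source)
    (hQ : IsQuadratic nabla π) : Mc = 0 := by
  have key : ∀ (p : M) (Y Z V : Vec (Smooth n M)) (α β : Form1 (Smooth n M)),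
      Mc (flat Om Y) (flat Om Z) (flat Om V) ![sharp π α, sharp π β] p = 0 := by
    intro p
    obtain ⟨e, hn, hp⟩ := hcover p
    obtain ⟨W, f, X, h⟩ := exists_coordFrame hn.1 hp
    have hbase : ∀ a b c i j, Mc (flat Om (X a)) (flat Om (X b)) (flat Om (X c))
        ![sharp π (d0 (f i)), sharp π (d0 (f j))] p = 0 := by
      intro a b c i j
      rw [hM, hOm.2, hOm.2, hOm.2, hOm.1, hOm.1, smooth_neg_apply, h.deriv3_coord hn h.mem]
      obtain ⟨P, hP, hev⟩ := hQ e hn p hp i j (f i) (f j) (h.isCoordNear h.mem i)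
        (h.isCoordNear h.mem j)
      rw [h.third_eq_zero_of_quadratic hP hev, neg_zero]
    -- Tensoriality replaces the frame by arbitrary arguments, one slot at a time.
    have h1 : ∀ a b c i β, Mc (flat Om (X a)) (flat Om (X b)) (flat Om (X c))
        ![sharp π (d0 (f i)), sharp π β] p = 0 := fun a b c i =>
      h.form_induction hn.1 h.mem
        (S := fun β => Mc (flat Om (X a)) (flat Om (X b)) (flat Om (X c))
          ![sharp π (d0 (f i)), sharp π β])
        (fun β β' => by rw [sharp_add, alt_add_right])
        (fun g β => by rw [sharp_smul, alt_smul_right]) (hbase a b c i)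
    have h2 : ∀ a b c α β, Mc (flat Om (X a)) (flat Om (X b)) (flat Om (X c))
        ![sharp π α, sharp π β] p = 0 := fun a b c α β =>
      h.form_induction hn.1 h.mem
        (S := fun α => Mc (flat Om (X a)) (flat Om (X b)) (flat Om (X c))
          ![sharp π α, sharp π β])
        (fun α α' => by rw [sharp_add, alt_add_left])
        (fun g α => by rw [sharp_smul, alt_smul_left]) (fun i => h1 a b c i β) α
    have h3 : ∀ a b V α β, Mc (flat Om (X a)) (flat Om (X b)) (flat Om V)
        ![sharp π α, sharp π β] p = 0 := fun a b V α β =>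
      h.vec_induction hn.1 h.mem
        (S := fun V => Mc (flat Om (X a)) (flat Om (X b)) (flat Om V) ![sharp π α, sharp π β])
        (fun V V' => by rw [flat_add, trilinear_add_right])
        (fun g V => by rw [flat_smul, trilinear_smul_right]) (fun c => h2 a b c α β) V
    have h4 : ∀ a Z V α β, Mc (flat Om (X a)) (flat Om Z) (flat Om V)
        ![sharp π α, sharp π β] p = 0 := fun a Z V α β =>
      h.vec_induction hn.1 h.mem
        (S := fun Z => Mc (flat Om (X a)) (flat Om Z) (flat Om V) ![sharp π α, sharp π β])
        (fun V V' => by rw [flat_add, trilinear_add_mid])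
        (fun g V => by rw [flat_smul, trilinear_smul_mid]) (fun b => h3 a b V α β) Z
    exact fun Y Z V α β => h.vec_induction hn.1 h.mem
        (S := fun Y => Mc (flat Om Y) (flat Om Z) (flat Om V) ![sharp π α, sharp π β])
        (fun V V' => by rw [flat_add, trilinear_add_left])
        (fun g V => by rw [flat_smul, trilinear_smul_left]) (fun a => h4 a Z V α β) Y
  ext1 α; ext1 β; ext1 γ
  refine alt_ext fun Y Z => ?_
  ext p
  have := key p (sharp π α) (sharp π β) (sharp π γ) (flat Om Y) (flat Om Z)
  rwa [hOm.1, hOm.1, hOm.1, hOm.2, hOm.2] at this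

end Quadratic

end Manifold


section TotalDifferentialAt

open Set Metric

set_option maxSynthPendingDepth 3

/-- **Frobenius theorem** for linear total differential equations, near an arbitrary point. -/
theorem exists_solution_of_flat_at {E F : Type*} [NormedAddCommGroup E] [NormedSpace ℝ E]
    [NormedAddCommGroup F] [NormedSpace ℝ F] [CompleteSpace F] {Γ : E → E →L[ℝ] F →L[ℝ] F}
    {U : Set E} {b : E} (hU : U ∈ 𝓝 b) (hΓ : ContDiffOn ℝ ∞ Γ U)
    (hflat : ∀ x ∈ U, ∀ v w ζ, fderiv ℝ Γ x v w ζ + Γ x w (Γ x v ζ) =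
      fderiv ℝ Γ x w v ζ + Γ x v (Γ x w ζ)) :
    ∃ r > 0, ball b r ⊆ U ∧ ∀ ζ₀ : F, ∃ ζ : E → F, ζ b = ζ₀ ∧
      (∀ x ∈ ball b r, HasFDerivAt ζ ((Γ x).flip (ζ x)) x) ∧ ContDiffOn ℝ ∞ ζ (ball b r) := by
  have hU' : (fun y => y + b) ⁻¹' U ∈ 𝓝 (0 : E) :=
    (by fun_prop : Continuous fun y : E => y + b).continuousAt.preimage_mem_nhds (by simpa using hU)
  have hfd : ∀ x, fderiv ℝ (fun y => Γ (y + b)) x = fderiv ℝ Γ (x + b) := fun x =>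
    fderiv_comp_add_right b
  obtain ⟨r, hr, hsub, h⟩ := exists_solution_of_flat (Γ := fun y => Γ (y + b)) hU'
    (hΓ.comp (by fun_prop) (fun y hy => hy))
    (fun x hx v w ζ => by rw [hfd]; exact hflat _ hx v w ζ)
  have hmem : ∀ x ∈ ball b r, x - b ∈ ball (0 : E) r := fun x hx => by
    rwa [mem_ball_zero_iff, ← dist_eq_norm]
  refine ⟨r, hr, fun x hx => by simpa using hsub (hmem x hx), fun ζ₀ => ?_⟩
  obtain ⟨ζ, h0, h1, h2⟩ := h ζ₀
  refine ⟨fun x => ζ (x - b), by simpa using h0, fun x hx => ?_,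
    h2.comp (by fun_prop) fun x hx => hmem x hx⟩
  have := h1 _ (hmem x hx)
  simp only [sub_add_cancel] at this
  exact (hasFDerivAt_comp_sub (f := ζ) b).2 this

end TotalDifferentialAt

/-! ### Functions with vanishing second covariant derivative -/

section AffineFunctions

open Set Metric

variable {n : ℕ}

local notation "𝔼" => EuclideanSpace ℝ (Fin n)

/-- The map `v ↦ ((u, ξ) ↦ (∑ vⁱ ξᵢ, 0))`. -/
def pairMap (n : ℕ) : EuclideanSpace ℝ (Fin n) →L[ℝ]
    (ℝ × (Fin n → ℝ)) →L[ℝ] (ℝ × (Fin n → ℝ)) :=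
  ∑ i, (EuclideanSpace.proj i : EuclideanSpace ℝ (Fin n) →L[ℝ] ℝ).smulRight
    ((ContinuousLinearMap.inl ℝ ℝ (Fin n → ℝ)).comp
      ((ContinuousLinearMap.proj i).comp (ContinuousLinearMap.snd ℝ ℝ (Fin n → ℝ))))

/-- The map `v ↦ ((u, ξ) ↦ (0, vⁱ ξₖ eₘ))`. -/
def unitMap (k i m : Fin n) : EuclideanSpace ℝ (Fin n) →L[ℝ]
    (ℝ × (Fin n → ℝ)) →L[ℝ] (ℝ × (Fin n → ℝ)) :=
  (EuclideanSpace.proj i : EuclideanSpace ℝ (Fin n) →L[ℝ] ℝ).smulRight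
    ((ContinuousLinearMap.inr ℝ ℝ (Fin n → ℝ)).comp
      (((ContinuousLinearMap.single ℝ (fun _ : Fin n => ℝ) m)).comp
      ((ContinuousLinearMap.proj k).comp (ContinuousLinearMap.snd ℝ ℝ (Fin n → ℝ)))))

lemma pairMap_apply (v : 𝔼) (ζ : ℝ × (Fin n → ℝ)) :
    pairMap n v ζ = (∑ i, v i * ζ.2 i, 0) := by
  have h : pairMap n v ζ = ∑ i, (v i * ζ.2 i, (0 : Fin n → ℝ)) := by
    simp [pairMap]
  rw [h]
  ext <;> simp [Prod.fst_sum, Prod.snd_sum]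

lemma unitMap_apply (k i m : Fin n) (v : 𝔼) (ζ : ℝ × (Fin n → ℝ)) :
    unitMap k i m v ζ = (0, Pi.single m (v i * ζ.2 k)) := by
  ext j
  · simp [unitMap]
  · by_cases h : j = m
    · subst h; simp [unitMap]
    · simp [unitMap, h]

lemma sum_unitMap_apply (c : Fin n → Fin n → Fin n → ℝ) (v : 𝔼) (ζ : ℝ × (Fin n → ℝ)) :
    (∑ k, ∑ i, ∑ m, c k i m • unitMap k i m) v ζ =
      (0, fun m => ∑ i, ∑ k, c k i m * v i * ζ.2 k) := by
  simp only [_root_.sum_apply, _root_.smul_apply, unitMap_apply]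
  ext j
  · simp [Prod.fst_sum]
  · simp only [Prod.snd_sum, Finset.sum_apply, Prod.smul_snd, Pi.smul_apply, smul_eq_mul,
      Pi.single_apply, mul_ite, mul_zero, Finset.sum_ite_eq, Finset.mem_univ, if_true]
    rw [Finset.sum_comm]
    exact Finset.sum_congr rfl fun i _ => Finset.sum_congr rfl fun k _ => by ring

lemma clm_eq_sum_single (L : 𝔼 →L[ℝ] ℝ) (v : 𝔼) :
    L v = ∑ i, v i * L (EuclideanSpace.single i 1) := by
  conv_lhs => rw [euclidean_eq_sum_single v]
  simp only [map_sum, map_smul, smul_eq_mul]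

set_option maxSynthPendingDepth 3 in
/-- Local existence of functions whose second derivatives with respect to a flat torsion-free
connection, given by its Christoffel symbols `γ k i j`, vanish. -/
theorem exists_affine_functions {γ : Fin n → Fin n → Fin n → 𝔼 → ℝ} {U : Set 𝔼} {b : 𝔼}
    (hU : U ∈ 𝓝 b) (hγ : ∀ k i j, ContDiffOn ℝ ∞ (γ k i j) U)
    (hsymm : ∀ y ∈ U, ∀ k i j, γ k i j y = γ k j i y)
    (hcurv : ∀ y ∈ U, ∀ i j l m,
      fderiv ℝ (γ l i m) y (EuclideanSpace.single j 1) + ∑ k, γ k i m y * γ l j k y =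
      fderiv ℝ (γ l j m) y (EuclideanSpace.single i 1) + ∑ k, γ k j m y * γ l i k y) :
    ∃ r > 0, ball b r ⊆ U ∧ ∃ (u : Fin n → 𝔼 → ℝ) (ξ : Fin n → Fin n → 𝔼 → ℝ),
      (∀ a i, ξ a i b = if i = a then 1 else 0) ∧ (∀ a, ContDiffOn ℝ ∞ (u a) (ball b r)) ∧
      (∀ y ∈ ball b r, ∀ a, ∃ u' : 𝔼 →L[ℝ] ℝ, HasFDerivAt (u a) u' y ∧ ∀ v : 𝔼, u' v = ∑ i, v i * ξ a i y) ∧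
      ∀ y ∈ ball b r, ∀ a m, ∃ ξ' : 𝔼 →L[ℝ] ℝ, HasFDerivAt (ξ a m) ξ' y ∧
        ∀ v : 𝔼, ξ' v = ∑ i, ∑ k, γ k i m y * v i * ξ a k y := by
  wlog hUo : IsOpen U generalizing U
  · obtain ⟨r, hr, hsub, h⟩ := this (U := interior U) (interior_mem_nhds.2 hU)
      (fun k i j => (hγ k i j).mono interior_subset) (fun y hy => hsymm y (interior_subset hy))
      (fun y hy => hcurv y (interior_subset hy)) isOpen_interior
    exact ⟨r, hr, hsub.trans interior_subset, h⟩
  -- For ζ = (u, ξ) the equation reads du = ξᵢ dxⁱ and dξₘ = γᵏᵢₘ ξₖ dxⁱ, which is ∇du = 0 as a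
  -- first-order system.
  set Γ : 𝔼 → 𝔼 →L[ℝ] (ℝ × (Fin n → ℝ)) →L[ℝ] (ℝ × (Fin n → ℝ)) := fun y =>
    pairMap n + ∑ k, ∑ i, ∑ m, γ k i m y • unitMap k i m with hΓ
  have happ : ∀ y v ζ, Γ y v ζ =
      (∑ i, v i * ζ.2 i, fun m => ∑ i, ∑ k, γ k i m y * v i * ζ.2 k) := by
    intro y v ζ
    simp only [hΓ, _root_.add_apply]
    rw [pairMap_apply, sum_unitMap_apply]
    simp
  have hΓc : ContDiffOn ℝ ∞ Γ U :=
    contDiffOn_const.add (ContDiffOn.sum fun k _ => ContDiffOn.sum fun i _ =>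
      ContDiffOn.sum fun m _ => (hγ k i m).smul contDiffOn_const)
  have hd : ∀ y ∈ U, ∀ k i m, HasFDerivAt (γ k i m) (fderiv ℝ (γ k i m) y) y :=
    fun y hy k i m => (((hγ k i m).contDiffAt (hUo.mem_nhds hy)).differentiableAt
      (by simp)).hasFDerivAt
  have hΓd : ∀ y ∈ U, ∀ v w ζ, fderiv ℝ Γ y v w ζ =
      (0, fun m => ∑ i, ∑ k, fderiv ℝ (γ k i m) y v * w i * ζ.2 k) := by
    intro y hy v w ζ
    have h1 : HasFDerivAt Γ (∑ k, ∑ i, ∑ m, (fderiv ℝ (γ k i m) y).smulRight (unitMap k i m)) y :=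
      (HasFDerivAt.fun_sum fun k _ => HasFDerivAt.fun_sum fun i _ => HasFDerivAt.fun_sum fun m _ =>
        (hd y hy k i m).smul_const (unitMap k i m)).const_add (pairMap n)
    rw [h1.fderiv, ← sum_unitMap_apply]
    simp only [_root_.sum_apply, ContinuousLinearMap.smulRight_apply]
  obtain ⟨r, hr, hsub, hsol⟩ := exists_solution_of_flat_at hU hΓc (by
    intro y hy v w ζ
    -- Symmetry of this expression in v and w is the symmetry of γ in the first component and
    -- vanishing curvature in the second.
    have expand : ∀ v w : 𝔼, fderiv ℝ Γ y v w ζ + Γ y w (Γ y v ζ) =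
        (∑ i, ∑ j, ∑ k, w i * v j * ζ.2 k * γ k j i y, fun m => ∑ i, ∑ j, ∑ l, w i * v j * ζ.2 l *
          (fderiv ℝ (γ l i m) y (EuclideanSpace.single j 1) + ∑ k, γ k i m y * γ l j k y)) := by
      intro v w
      rw [hΓd y hy, happ, happ]
      ext m
      · simp only [Prod.fst_add, zero_add, Finset.mul_sum]
        exact Finset.sum_congr rfl fun i _ => Finset.sum_congr rfl fun j _ =>
          Finset.sum_congr rfl fun k _ => by ring
      · simp only [Prod.snd_add, Pi.add_apply, mul_add, Finset.sum_add_distrib, Finset.mul_sum]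
        congr 1
        · refine Finset.sum_congr rfl fun i _ => ?_
          rw [Finset.sum_comm]
          refine Finset.sum_congr rfl fun l _ => ?_
          rw [clm_eq_sum_single _ v, Finset.sum_mul, Finset.sum_mul]
          exact Finset.sum_congr rfl fun j _ => by ring
        · refine Finset.sum_congr rfl fun i _ => ?_
          rw [Finset.sum_comm]
          refine Finset.sum_congr rfl fun j _ => ?_
          rw [Finset.sum_comm]
          exact Finset.sum_congr rfl fun l _ => Finset.sum_congr rfl fun k _ => by ring
    rw [expand v w, expand w v]
    ext m
    · simp only
      rw [Finset.sum_comm]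
      exact Finset.sum_congr rfl fun i _ => Finset.sum_congr rfl fun j _ =>
        Finset.sum_congr rfl fun k _ => by rw [hsymm y hy k i j]; ring
    · simp only
      rw [Finset.sum_comm]
      exact Finset.sum_congr rfl fun i _ => Finset.sum_congr rfl fun j _ =>
        Finset.sum_congr rfl fun l _ => by rw [hcurv y hy j i l m]; ring)
  -- The a-th solution has differential dxᵃ at b, so together they have identity derivative there.
  choose ζ hζ0 hζ hζc using fun a : Fin n => hsol (0, Pi.single a 1)
  refine ⟨r, hr, hsub, fun a y => (ζ a y).1, fun a i y => (ζ a y).2 i, fun a i => ?_, fun a => ?_,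
    fun y hy a => ⟨_, (hζ a y hy).fst, fun v => ?_⟩,
    fun y hy a m => ⟨_, hasFDerivAt_pi'.1 (hζ a y hy).snd m, fun v => ?_⟩⟩
  · simp [hζ0, Pi.single_apply]
  · exact contDiff_fst.comp_contDiffOn (hζc a)
  · simp [happ]
  · simp [happ]

end AffineFunctions


/-! ### Inverse function theorem, with smooth inverse on an open set -/

section InverseFunction

open Set

/-- A smooth map with invertible derivative at a point restricts to a diffeomorphism of open
sets. -/
lemma exists_local_diffeo {E : Type*} [NormedAddCommGroup E] [NormedSpace ℝ E] [CompleteSpace E]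
    {Φ : E → E} {V : Set E} (hV : IsOpen V) (hΦ : ContDiffOn ℝ ∞ Φ V) {b : E} (hb : b ∈ V)
    {L : E ≃L[ℝ] E} (hL : HasFDerivAt Φ (L : E →L[ℝ] E) b) :
    ∃ φ : OpenPartialHomeomorph E E, (∀ y, φ y = Φ y) ∧ b ∈ φ.source ∧ φ.source ⊆ V ∧
      ContDiffOn ℝ ∞ φ.symm φ.target := by
  have hat : ∀ y ∈ V, ContDiffAt ℝ ∞ Φ y := fun y hy => hΦ.contDiffAt (hV.mem_nhds hy)
  -- Keeping the derivative invertible throughout makes the inverse smooth on the whole target, not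
  -- only at Φ(b).
  set V' := V ∩ fderiv ℝ Φ ⁻¹' range ((↑) : (E ≃L[ℝ] E) → E →L[ℝ] E) with hV'
  have hV'o : IsOpen V' :=
    (hΦ.continuousOn_fderiv_of_isOpen hV (by simp)).isOpen_inter_preimage hV
      ContinuousLinearEquiv.isOpen
  set φ := ((hat b hb).toOpenPartialHomeomorph Φ hL (by simp)).restrOpen V' hV'o with hφ
  have hsrc : φ.source ⊆ V' := inter_subset_right
  refine ⟨φ, fun y => rfl, ⟨(hat b hb).mem_toOpenPartialHomeomorph_source hL (by simp), hb,
    L, hL.fderiv.symm⟩, hsrc.trans inter_subset_left, fun z hz => ?_⟩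
  have hz' := hsrc (φ.map_target hz)
  obtain ⟨L', hL'⟩ := hz'.2
  have hd : HasFDerivAt φ (L' : E →L[ℝ] E) (φ.symm z) := by
    rw [hL']
    exact ((hat _ hz'.1).differentiableAt (by simp)).hasFDerivAt
  exact (φ.contDiffAt_symm hz hd (hat _ hz'.1)).contDiffWithinAt

end InverseFunction

/-! ### Existence of affine charts -/

section AffineCharts

open Set

variable {n : ℕ} {M : Type*} [TopologicalSpace M] [T2Space M]
  [ChartedSpace (EuclideanSpace ℝ (Fin n)) M] [IsManifold (𝓡 n) ∞ M]
  {nabla : AffineConnection (Smooth n M)}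
  {e : OpenPartialHomeomorph M (EuclideanSpace ℝ (Fin n))}
  {p : M} {W : Set M} {f : Fin n → Smooth n M} {X : Fin n → Vec (Smooth n M)}

namespace IsCoordFrame

lemma lie_apply_coord (h : IsCoordFrame e p W f X) {q : M} (hq : q ∈ W) (i j k : Fin n) :
    ⁅X i, X j⁆ (f k) q = 0 := by
  rw [Derivation.commutator_apply, smooth_sub_apply, h.field_field_coord hq,
    h.field_field_coord hq, sub_zero]

lemma christoffel_symm (h : IsCoordFrame e p W f X) (htf : nabla.IsTorsionFree) {q : M}
    (hq : q ∈ W) (i j k : Fin n) :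
    nabla.toFun (X i) (X j) (f k) q = nabla.toFun (X j) (X i) (f k) q := by
  have h1 := congrArg (fun Y : Vec (Smooth n M) => Y (f k) q) (htf (X i) (X j))
  simp only [Derivation.sub_apply, smooth_sub_apply, h.lie_apply_coord hq, Derivation.zero_apply,
    smooth_zero_apply, sub_zero] at h1
  exact sub_eq_zero.1 h1

/-- (∇ᵢV)ᵐ = ∂ᵢVᵐ + Vˡ Γᵐᵢₗ, obtained by expanding the 1-form ∇ᵢ dxᵐ in the frame, so that V is
never expanded. -/
lemma nabla_apply_coord (h : IsCoordFrame e p W f X)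
    (he : e ∈ IsManifold.maximalAtlas (𝓡 n) ∞ M) {q : M} (hq : q ∈ W) (i m : Fin n)
    (V : Vec (Smooth n M)) : nabla.toFun (X i) V (f m) q =
      X i (V (f m)) q + ∑ l, V (f l) q * nabla.toFun (X i) (X l) (f m) q := by
  have h1 := h.form_apply he hq (nabla.onForm1 (X i) (d0 (f m))) V
  simp only [AffineConnection.onForm1_apply, d0_apply, smooth_sub_apply, h.field_field_coord hq,
    zero_sub, mul_neg, Finset.sum_neg_distrib] at h1
  linarith

lemma christoffel_curvature (h : IsCoordFrame e p W f X)
    (he : e ∈ IsManifold.maximalAtlas (𝓡 n) ∞ M) (hflat : nabla.IsFlat) {q : M} (hq : q ∈ W)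
    (i j l m : Fin n) :
    X j (nabla.toFun (X i) (X m) (f l)) q +
        ∑ k, nabla.toFun (X i) (X m) (f k) q * nabla.toFun (X j) (X k) (f l) q =
      X i (nabla.toFun (X j) (X m) (f l)) q +
        ∑ k, nabla.toFun (X j) (X m) (f k) q * nabla.toFun (X i) (X k) (f l) q := by
  have h1 := congrArg (fun Y : Vec (Smooth n M) => Y (f l) q) (hflat (X j) (X i) (X m))
  -- The commutator is known to vanish only over W, so function-linearity of ∇ in its direction is
  -- needed.
  have h2 : nabla.toFun ⁅X j, X i⁆ (X m) (f l) q = 0 := by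
    let S : Form1 (Smooth n M) :=
      { toFun := fun Y => nabla.toFun Y (X m) (f l)
        map_add' := fun Y Y' => by rw [nabla.add_left]; rfl
        map_smul' := fun g Y => by rw [nabla.smul_left]; rfl }
    have h3 := h.form_apply he hq S ⁅X j, X i⁆
    simp only [h.lie_apply_coord hq, zero_mul, Finset.sum_const_zero] at h3
    exact h3
  simp only [Derivation.sub_apply, smooth_sub_apply, h2, Derivation.zero_apply,
    smooth_zero_apply, sub_zero] at h1
  rw [h.nabla_apply_coord he hq j l (nabla.toFun (X i) (X m)),
    h.nabla_apply_coord he hq i l (nabla.toFun (X j) (X m))] at h1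
  exact sub_eq_zero.1 h1

end IsCoordFrame

/-- The affine charts of a flat torsion-free connection cover the manifold. -/
theorem exists_isAffineChart (hflat : nabla.IsFlat) (htf : nabla.IsTorsionFree) (p : M) :
    ∃ e, IsAffineChart nabla e ∧ p ∈ e.source := by
  set e := chartAt (EuclideanSpace ℝ (Fin n)) p with he_def
  have he : e ∈ IsManifold.maximalAtlas (𝓡 n) ∞ M :=
    IsManifold.chart_mem_maximalAtlas (I := 𝓡 n) (n := ∞) p
  have hp : p ∈ e.source := mem_chart_source _ p
  obtain ⟨W, f, X, h⟩ := exists_coordFrame he hp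
  set U : Set (EuclideanSpace ℝ (Fin n)) := e.target ∩ e.symm ⁻¹' W with hU
  have hUo : IsOpen U := e.symm.isOpen_inter_preimage h.isOpen
  have hbU : e p ∈ U := ⟨e.map_source hp, by rw [mem_preimage, e.left_inv hp]; exact h.mem⟩
  set γ : Fin n → Fin n → Fin n → EuclideanSpace ℝ (Fin n) → ℝ :=
    fun k i j => nabla.toFun (X i) (X j) (f k) ∘ e.symm with hγ
  have hfield : ∀ y ∈ U, ∀ (g : Smooth n M) i,
      fderiv ℝ (g ∘ e.symm) y (EuclideanSpace.single i 1) = X i g (e.symm y) := by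
    intro y hy g i
    rw [h.field _ hy.2, chartDeriv, e.right_inv hy.1]
  obtain ⟨r, hr, hsub, u, ξ, hξ0, huc, hu, hξ⟩ := exists_affine_functions (hUo.mem_nhds hbU)
    (γ := γ) (fun k i j => (contDiffOn_comp_symm he _).mono inter_subset_left)
    (fun y hy k i j => h.christoffel_symm htf hy.2 i j k)
    (fun y hy i j l m => by
      simp only [hγ, hfield y hy]
      exact h.christoffel_curvature he hflat hy.2 i j l m)
  have hball : ∀ {q}, q ∈ e.source → e q ∈ Metric.ball (e p) r → q ∈ W := fun {q} hq hqb => by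
    have := (hsub hqb).2
    rwa [mem_preimage, e.left_inv hq] at this
  set Φ : EuclideanSpace ℝ (Fin n) → EuclideanSpace ℝ (Fin n) :=
    fun y => WithLp.toLp 2 fun a => u a y with hΦ
  have hΦc : ContDiffOn ℝ ∞ Φ (Metric.ball (e p) r) := (contDiffOn_piLp 2).2 fun a => huc a
  have hΦd : HasFDerivAt Φ ((ContinuousLinearEquiv.refl ℝ (EuclideanSpace ℝ (Fin n)) :
      EuclideanSpace ℝ (Fin n) ≃L[ℝ] EuclideanSpace ℝ (Fin n)) :
      EuclideanSpace ℝ (Fin n) →L[ℝ] EuclideanSpace ℝ (Fin n)) (e p) := by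
    rw [← hasFDerivWithinAt_univ, hasFDerivWithinAt_piLp]
    intro a
    rw [hasFDerivWithinAt_univ]
    obtain ⟨u', hu', hv⟩ := hu (e p) (Metric.mem_ball_self hr) a
    refine hu'.congr_fderiv ?_
    ext v
    rw [hv]
    simp [hξ0]
  obtain ⟨φ, hφ, hbφ, hφs, hφc⟩ := exists_local_diffeo Metric.isOpen_ball hΦc
    (Metric.mem_ball_self hr) hΦd
  have hφc' : ContDiffOn ℝ ∞ φ φ.source := (hΦc.mono hφs).congr fun y _ => hφ y
  refine ⟨e.trans φ, ⟨?_, ?_⟩, by simp [hp, hbφ]⟩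
  · refine OpenPartialHomeomorph.mem_maximalAtlas_of_contMDiffOn _ ?_ ?_
    · refine (contMDiffOn_iff_contDiffOn.2 hφc').comp
        ((contMDiffOn_of_mem_maximalAtlas he).mono ?_) ?_
      · exact fun q hq => ((e.trans_source φ) ▸ hq).1
      · exact fun q hq => ((e.trans_source φ) ▸ hq).2
    · refine (contMDiffOn_symm_of_mem_maximalAtlas he).comp
        ((contMDiffOn_iff_contDiffOn.2 hφc).mono ?_) ?_
      · exact fun q hq => ((e.trans_target φ) ▸ hq).1
      · exact fun q hq => ((e.trans_target φ) ▸ hq).2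
  · intro q hq a g hg Y Z
    have hq' : q ∈ e.source ∧ e q ∈ φ.source := by rwa [e.trans_source] at hq
    have hqW : q ∈ W := hball hq'.1 (hφs hq'.2)
    have hgu : g ∘ e.symm =ᶠ[𝓝 (e q)] u a := by
      have hc := e.continuousAt_symm (e.map_source hq'.1)
      rw [ContinuousAt, e.left_inv hq'.1] at hc
      filter_upwards [hc.eventually hg, e.open_target.mem_nhds (e.map_source hq'.1)] with y hy hy'
      rw [Function.comp_apply, hy, OpenPartialHomeomorph.trans_apply, e.right_inv hy', hφ]
    have hballq : Metric.ball (e p) r ∈ 𝓝 (e q) := Metric.isOpen_ball.mem_nhds (hφs hq'.2)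
    have hfirst : ∀ᶠ y in 𝓝 (e q), ∀ j, X j g (e.symm y) = ξ a j y := by
      filter_upwards [hgu.eventuallyEq_nhds, hballq] with y hy hyb j
      obtain ⟨u', hu', hv⟩ := hu y hyb a
      rw [← hfield y (hsub hyb), hy.fderiv_eq, hu'.fderiv, hv]
      simp
    have hfirst' : ∀ k, X k g q = ξ a k (e q) := fun k => by
      have := hfirst.self_of_nhds k
      rwa [e.left_inv hq'.1] at this
    -- The equation for ξ, transported to the manifold; it says that ∇dg vanishes on the coordinate
    -- frame at q.
    have hsecond : ∀ i j, X i (X j g) q =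
        ∑ k, nabla.toFun (X i) (X j) (f k) q * X k g q := by
      intro i j
      obtain ⟨ξ', hξ', hv⟩ := hξ (e q) (hφs hq'.2) a j
      have hev : X j g ∘ e.symm =ᶠ[𝓝 (e q)] ξ a j := hfirst.mono fun y hy => hy j
      have h1 := hfield (e q) (hsub (hφs hq'.2)) (X j g) i
      rw [e.left_inv hq'.1] at h1
      rw [← h1, hev.fderiv_eq, hξ'.fderiv, hv]
      simp [hγ, e.left_inv hq'.1, hfirst']
    have hframe : ∀ i j, nabla.onForm1 (X i) (d0 g) (X j) q = 0 := by
      intro i j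
      rw [AffineConnection.onForm1_apply, d0_apply, d0_apply, smooth_sub_apply, hsecond,
        h.derivation_apply he hqW (nabla.toFun (X i) (X j)) g, sub_self]
    have hright : ∀ i, nabla.onForm1 (X i) (d0 g) Z q = 0 := fun i =>
      h.vec_induction he hqW (S := fun Z => nabla.onForm1 (X i) (d0 g) Z)
        (fun V V' => map_add _ V V') (fun k V => map_smul _ k V) (hframe i) Z
    exact h.vec_induction he hqW (S := fun Y => nabla.onForm1 Y (d0 g) Z)
      (fun V V' => by rw [nabla.onForm1_add_left]; rfl)
      (fun k V => by rw [nabla.onForm1_smul_left]; rfl) hright Y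

end AffineCharts

end PoissonGeometry

end

theorem mainTheorem6 {n : ℕ} {M : Type*} [TopologicalSpace M] [T2Space M]
    [SecondCountableTopology M] [ChartedSpace (EuclideanSpace ℝ (Fin n)) M]
    [IsManifold (𝓡 n) ∞ M]
    (π : Bivec (Smooth n M)) (hπ : IsPoisson π)
    (Om : Form2 (Smooth n M)) (hOm : IsInverse π Om)
    (D : ContravariantConnection π) (hflat : D.IsFlat) (htf : D.IsTorsionFree) :
    (∃! nabla : AffineConnection (Smooth n M), IsAssociated D nabla) ∧
    (∃! Mc, D.IsMetacurvature Mc) ∧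
    ∀ nabla Mc, IsAssociated D nabla → D.IsMetacurvature Mc →
      nabla.IsFlat ∧ nabla.IsTorsionFree ∧
      -- `M^{ijk}_{lm} = D^i D^j D^k ω_{lm}`
      (∀ α β γ, Mc α β γ = D.deriv3 Om α β γ) ∧
      -- `M(α,β,γ)(X,Y) = -(∇³π)(#α,#β,#γ)(X ⌟ ω, Y ⌟ ω)`
      (∀ α β γ X Y, Mc α β γ ![X, Y] =
        -(nabla.deriv3 π (sharp π α) (sharp π β) (sharp π γ)) ![flat Om X, flat Om Y]) ∧
      -- the affine charts of `∇` cover `M`, and `M = 0` iff `π` is quadratic in them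
      (∀ p : M, ∃ e, IsAffineChart nabla e ∧ p ∈ e.source) ∧
      (Mc = 0 ↔ IsQuadratic nabla π) := by
  have hA : ExactFormsSeparate (Smooth n M) := exactFormsSeparate_smooth
  have hmeta := D.isMetacurvature_deriv3Linear hA hπ hOm hflat htf
  refine ⟨⟨associatedConnection D hOm, isAssociated_associatedConnection D hOm,
    fun nabla h => h.eq_associatedConnection hOm⟩,
    ⟨D.deriv3Linear Om, hmeta, fun Mc h => h.unique hA hmeta⟩, fun nabla Mc hn hM => ?_⟩
  have hMc : ∀ α β γ, Mc α β γ = D.deriv3 Om α β γ := fun α β γ => by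
    rw [hM.unique hA hmeta, D.deriv3Linear_apply]
  have hMn : ∀ α β γ X Y, Mc α β γ ![X, Y] =
      -(nabla.deriv3 π (sharp π α) (sharp π β) (sharp π γ)) ![flat Om X, flat Om Y] :=
    fun α β γ X Y => by rw [hMc, hn.deriv3_eq hA hOm, lowerBivec_apply]
  have hnf := hn.isFlat hA hπ hOm hflat
  have hnt := hn.isTorsionFree hA hπ hOm htf
  have hcover := exists_isAffineChart hnf hnt
  exact ⟨hnf, hnt, hMc, hMn, hcover, isQuadratic_of_metacurvature_eq_zero hOm hMn,
    metacurvature_eq_zero_of_isQuadratic hOm hMn hcover⟩
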